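/- **Setting.** Let $A$ be a (not necessarily unital) $C^*$-algebra and $k\ge 0$. A $C^*$-correspondence over $A$ is a right Hilbert $C^*$-module $E$ over $A$ with a left action of $A$ given by a $*$-homomorphism $\varphi_E$ into the adjointable operators on $E$. If $\sigma$ is a representation of $A$ on a Hilbert space $H$, then $E\otimes_\sigma H$ is the Hausdorff completion of the algebraic tensor product for $\langle \xi\otimes h,\eta\otimes g\rangle=\langle h,\sigma(\langle\xi,\eta\rangle)g\rangle$ (inner products linear in the second variable). Let $X=\{X(\mathbf n)\}_{\mathbf n\in\mathbb Z_+^k}$ be a product system over $\mathbb Z_+^k$ of $C^*$-correspondences over $A$: $X(\mathbf 0)=A$; there is an associative multiplication $X(\mathbf p)\times X(\mathbf m)\to X(\mathbf p+\mathbf m)$, which for $\mathbf p,\mathbf m\neq\mathbf 0$ extends to an isomorphism of correspondences $X(\mathbf p)\otimes_A X(\mathbf m)\cong X(\mathbf p+\mathbf m)$; and multiplication by elements of $X(\mathbf 0)=A$ is given by the left and right actions. Write $\mathbf e_i$ for the standard generators, $E_i=X(\mathbf e_i)$, $\mathbf e(u)=\sum_{i\in u}\mathbf e_i$ for $u\subseteq\{1,\dots,k\}$,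 and $t_{i,j}:E_i\otimes E_j\to E_j\otimes E_i$ for the isomorphism obtained by identifying both sides with $X(\mathbf e_i+\mathbf e_j)$ through the multiplication. Below, $X(\mathbf p)\otimes X(\mathbf m)\otimes H$ is identified with $X(\mathbf p+\mathbf m)\otimes_\sigma H$, and $X(\mathbf 0)\otimes_\sigma H$ with $H$ when $\sigma$ is nondegenerate. A *representation* of $X$ on $H$ consists of a $*$-representation $\sigma$ of $A$ on $H$ and linear maps $T_{\mathbf n}:X(\mathbf n)\to B(H)$ with $T_{\mathbf 0}=\sigma$, $T_{\mathbf n}(a\xi b)=\sigma(a)T_{\mathbf n}(\xi)\sigma(b)$, $T_{\mathbf p+\mathbf m}(xy)=T_{\mathbf p}(x)T_{\mathbf m}(y)$, such that $T_{\mathbf n}$ is completely contractive for $\mathbf n\ne\mathbf 0$. It is a *c.c. representation* if moreover $\sigma$ is nondegenerate. Put $T^{(i)}=T_{\mathbf e_i}$, let $\tilde T_{\mathbf n}:X(\mathbf n)\otimes_\sigma H\to H$ be the contraction $\xi\otimes h\mapsto T_{\mathbf n}(\xi)h$, and $\tilde T^{(i)}=\tilde T_{\mathbf e_i}$. For $\mathbf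 n\in\mathbb Z^k$ with positive and negative parts $\mathbf n_+,\mathbf n_-$, put $T(\mathbf n)=\tilde T_{\mathbf n_-}^*\tilde T_{\mathbf n_+}$. The representation is *doubly commuting* if for all $i\ne j$ $$\tilde T^{(j)*}\tilde T^{(i)}=(I_{\mathbf e_j}\otimes\tilde T^{(i)})(t_{i,j}\otimes I_H)(I_{\mathbf e_i}\otimes\tilde T^{(j)*}).$$ A *regular isometric dilation* of a c.c. representation $(\sigma,\{T^{(i)}\})$ on $H$ is a representation $(\rho,\{V^{(i)}\})$ of $X$ on a Hilbert space $K\supseteq H$ such that (i) each $\tilde V^{(i)}$ is an isometry; (ii) $H$ is invariant under every $V^{(i)}(\xi)^*$, $\xi\in E_i$; (iii) $H$ reduces $\rho$ and $\rho(a)|_H=\sigma(a)$ for $a\in A$; (iv) $(I_{X(\mathbf n_-)}\otimes P_H)V(\mathbf n)|_{X(\mathbf n_+)\otimes H}=T(\mathbf n)$ for every $\mathbf n\in\mathbb Z^k$. It is *minimal* if $K$ is the smallest closed subspace of $K$ that contains $H$ and is invariant under all $V^{(i)}(\xi)$, $\xi\in E_i$. **Theorem.** Let $(\sigma,\{T^{(i)}\})$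 be a doubly commuting c.c. representation of $X$ on $H$. Then: 1. For every $v\subseteq\{1,\dots,k\}$, the operators $I_{\mathbf e(v)}\otimes I_H-I_{\mathbf e(v)-\mathbf e_i}\otimes\tilde T^{(i)*}\tilde T^{(i)}$, $i\in v$, on $X(\mathbf e(v))\otimes_\sigma H$ are positive and commute with each other, and $$\sum_{u\subseteq v}(-1)^{|u|}\bigl(I_{\mathbf e(v)-\mathbf e(u)}\otimes\tilde T_{\mathbf e(u)}^*\tilde T_{\mathbf e(u)}\bigr)=\prod_{i\in v}\bigl(I_{\mathbf e(v)}\otimes I_H-I_{\mathbf e(v)-\mathbf e_i}\otimes\tilde T^{(i)*}\tilde T^{(i)}\bigr)\ \ge 0 .$$ 2. $(\sigma,\{T^{(i)}\})$ has a minimal regular isometric dilation. 3. Every minimal regular isometric dilation $(\rho,\{V^{(i)}\})$ of $(\sigma,\{T^{(i)}\})$ is doubly commuting; and if the left action of $A$ on each $E_i$ is nondegenerate (the vectors $\varphi_{E_i}(a)\xi$ span a dense subspace of $E_i$), then $\rho$ is nondegenerate. -/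

import Mathlib

open scoped TensorProduct InnerProductSpace

/-! ### Positivity of matrices over a C*-algebra -/

theorem exists_negPart_compression {B : Type*} [NonUnitalCStarAlgebra B] [PartialOrder B]
    [StarOrderedRing B] (M : B) (hM : IsSelfAdjoint M) :
    ∃ P : B, 0 ≤ P ∧ star P = P ∧ star P * M * P = -(star P * P * P) ∧
      (∃ D : B, star P * P * P = star D * D) ∧ (P = 0 → 0 ≤ M) := by
  have hPs : star M⁻ = M⁻ := (IsSelfAdjoint.of_nonneg (CFC.negPart_nonneg M)).star_eq
  refine ⟨M⁻, CFC.negPart_nonneg M, hPs, ?_, CStarAlgebra.nonneg_iff_eq_star_mul_self.mp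
    (star_left_conjugate_nonneg (CFC.negPart_nonneg M) _), (CFC.negPart_eq_zero_iff M hM).mp⟩
  have h : M⁻ * M = -(M⁻ * M⁻) := by
    calc M⁻ * M = M⁻ * (M⁺ - M⁻) := by rw [CFC.posPart_sub_negPart M hM]
      _ = -(M⁻ * M⁻) := by rw [mul_sub, CFC.negPart_mul_posPart, zero_sub]
  rw [hPs, h, neg_mul]

theorem cstarMatrix_nonneg_of_forall {A : Type*} [NonUnitalCStarAlgebra A] [PartialOrder A]
    [StarOrderedRing A] {ι : Type*} [Fintype ι] (M : CStarMatrix ι ι A)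
    (hM : IsSelfAdjoint M)
    (hpos : ∀ c : ι → A, 0 ≤ ∑ i, ∑ j, star (c i) * M i j * c j) : 0 ≤ M := by
  obtain ⟨P, hP0, hPs, h1, ⟨D, hD⟩, hP⟩ := exists_negPart_compression M hM
  refine hP ?_
  have hD0 : D = 0 := by
    have key : ∀ k j, D j k = 0 := by
      intro k
      have e1 : (star P * M * P) k k = ∑ i, ∑ j, star (P i k) * M i j * P j k := by
        simp only [CStarMatrix.mul_apply, CStarMatrix.star_apply, Finset.sum_mul]
        rw [Finset.sum_comm]
      have e2 : (star D * D) k k = ∑ j, star (D j k) * D j k := by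
        simp only [CStarMatrix.mul_apply, CStarMatrix.star_apply]
      have h3 := hpos (fun i => P i k)
      rw [← e1, h1, hD] at h3
      have h4 : (-(star D * D)) k k = -((star D * D) k k) := rfl
      rw [h4, e2] at h3
      have h5 : ∑ j, star (D j k) * D j k = 0 :=
        le_antisymm (by simpa using h3) (Finset.sum_nonneg fun j _ => star_mul_self_nonneg _)
      intro j
      have := (Finset.sum_eq_zero_iff_of_nonneg
        (fun j _ => star_mul_self_nonneg (D j k))).mp h5 j (Finset.mem_univ j)
      exact CStarRing.star_mul_self_eq_zero_iff _ |>.mp this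
    ext j k
    exact key k j
  have h6 : star (P * P) * (P * P) = 0 := by
    have : star P * P * P = 0 := by rw [hD, hD0]; simp
    rw [star_mul, hPs]
    rw [hPs] at this
    rw [mul_assoc, ← mul_assoc P P P, this, mul_zero]
  have h7 : star P * P = 0 := by
    rw [hPs]; exact CStarRing.star_mul_self_eq_zero_iff _ |>.mp h6
  exact CStarRing.star_mul_self_eq_zero_iff _ |>.mp h7

theorem exists_star_mul_self_of_nonneg {B : Type*} [NonUnitalCStarAlgebra B] [PartialOrder B]
    [StarOrderedRing B] {M : B} (hM : 0 ≤ M) : ∃ N : B, M = star N * N :=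
  CStarAlgebra.nonneg_iff_eq_star_mul_self.mp hM

/-- A matrix over `A` that is self-adjoint and positive on column vectors over `A` is sent by a
representation of `A` to a positive operator matrix. -/
theorem re_sum_inner_nonneg {A : Type*} [NonUnitalCStarAlgebra A] [PartialOrder A]
    [StarOrderedRing A] {H : Type*} [NormedAddCommGroup H] [InnerProductSpace ℂ H]
    [CompleteSpace H] (σ : A →⋆ₙₐ[ℂ] (H →L[ℂ] H)) {ι : Type*} [Fintype ι] (g : ι → ι → A)
    (hg : ∀ i j, star (g i j) = g j i)
    (hpos : ∀ c : ι → A, 0 ≤ ∑ i, ∑ j, star (c i) * g i j * c j) (h : ι → H) :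
    0 ≤ (∑ i, ∑ j, ⟪h i, σ (g i j) (h j)⟫_ℂ).re := by
  have h0 : 0 ≤ (CStarMatrix.ofMatrix (Matrix.of g) : CStarMatrix ι ι A) := by
    refine cstarMatrix_nonneg_of_forall _ ?_ hpos
    ext i j
    exact hg j i
  obtain ⟨N, hN⟩ := exists_star_mul_self_of_nonneg h0
  have hN' : ∀ i j, g i j = ∑ k, star (N k i) * N k j := by
    intro i j
    have := congrArg (fun M : CStarMatrix ι ι A => M i j) hN
    simpa [CStarMatrix.mul_apply, CStarMatrix.star_apply] using this
  have key : ∑ i, ∑ j, ⟪h i, σ (g i j) (h j)⟫_ℂ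
      = ∑ k, ⟪∑ i, σ (N k i) (h i), ∑ j, σ (N k j) (h j)⟫_ℂ := by
    simp only [hN', map_sum, map_mul, map_star, sum_inner, inner_sum, sum_apply,
      mul_apply_eq_comp, ContinuousLinearMap.star_eq_adjoint,
      ContinuousLinearMap.adjoint_inner_right]
    calc _ = ∑ i, ∑ k, ∑ j, ⟪σ (N k i) (h i), σ (N k j) (h j)⟫_ℂ :=
          Finset.sum_congr rfl fun i _ => Finset.sum_comm
      _ = ∑ k, ∑ i, ∑ j, ⟪σ (N k i) (h i), σ (N k j) (h j)⟫_ℂ := Finset.sum_comm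
      _ = _ := Finset.sum_congr rfl fun k _ => Finset.sum_comm
  rw [key, Complex.re_sum]
  exact Finset.sum_nonneg fun k _ => inner_self_nonneg (𝕜 := ℂ)

theorem exists_sub_sq {A : Type*} [NonUnitalCStarAlgebra A] [PartialOrder A]
    [StarOrderedRing A] {b : A} (hb : 0 ≤ b) :
    ∃ d : A, star d = d ∧ b = (2 * Real.sqrt ‖b‖ : ℂ) • d - d * d := by
  have hsa : IsSelfAdjoint b := IsSelfAdjoint.of_nonneg hb
  let f : ℝ → ℝ := fun t => Real.sqrt ‖b‖ - Real.sqrt (‖b‖ - t)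
  have hf0 : f 0 = 0 := by simp [f]
  have hfc : Continuous f := by fun_prop
  refine ⟨cfcₙ f b, (cfcₙ_predicate f b : IsSelfAdjoint _).star_eq, ?_⟩
  have e : (2 * Real.sqrt ‖b‖ : ℂ) • cfcₙ f b = (2 * Real.sqrt ‖b‖ : ℝ) • cfcₙ f b := by
    rw [← Complex.coe_smul]; simp
  rw [e, ← cfcₙ_smul _ f b, ← cfcₙ_mul f f b, ← cfcₙ_sub _ _ b]
  conv_lhs => rw [← cfcₙ_id' ℝ b]
  refine cfcₙ_congr fun t ht => ?_
  have h1 : t ≤ ‖b‖ :=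
    (le_abs_self t).trans (by
      have := norm_apply_le_norm_cfcₙ (fun x : ℝ => x) b ht
      rwa [cfcₙ_id' ℝ b] at this)
  have h2 := Real.mul_self_sqrt (norm_nonneg b)
  have h3 := Real.mul_self_sqrt (sub_nonneg.mpr h1)
  simp only [f, smul_eq_mul]
  nlinarith

/-! ### C*-correspondences -/

/-- A C*-correspondence over the C*-algebra `A`: a complete *right* Hilbert `A`-module `E`, whose
`A`-valued inner product `ip` is linear in the second variable, together with a left action of `A`
by adjointable operators, given by a `*`-homomorphism `a ↦ lact a`. -/
class CStarCorrespondence (A : Type*) (E : Type*) [NonUnitalCStarAlgebra A] [PartialOrder A]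
    [StarOrderedRing A] [NormedAddCommGroup E] [NormedSpace ℂ E] [CompleteSpace E] where
  /-- The `A`-valued inner product `⟨x, y⟩`. -/
  ip : E → E → A
  /-- The right action: `ract a x = x · a`. -/
  ract : A →ₗ[ℂ] E →ₗ[ℂ] E
  /-- The left action: `lact a x = φ(a) x`. -/
  lact : A →ₗ[ℂ] E →ₗ[ℂ] E
  ip_add_right : ∀ x y z, ip x (y + z) = ip x y + ip x z
  ip_smul_right : ∀ (c : ℂ) (x y : E), ip x (c • y) = c • ip x y
  ip_ract_right : ∀ (a : A) (x y : E), ip x (ract a y) = ip x y * a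
  star_ip : ∀ x y, star (ip x y) = ip y x
  ip_self_nonneg : ∀ x, 0 ≤ ip x x
  norm_sq_eq : ∀ x, ‖x‖ ^ 2 = ‖ip x x‖
  ract_mul : ∀ (a b : A) (x : E), ract (a * b) x = ract b (ract a x)
  lact_mul : ∀ (a b : A) (x : E), lact (a * b) x = lact a (lact b x)
  lact_ract : ∀ (a b : A) (x : E), lact a (ract b x) = ract b (lact a x)
  ip_lact_left : ∀ (a : A) (x y : E), ip (lact a x) y = ip x (lact (star a) y)

namespace CStarCorrespondence

variable {A : Type*} {E : Type*} [NonUnitalCStarAlgebra A] [PartialOrder A]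
    [StarOrderedRing A] [NormedAddCommGroup E] [NormedSpace ℂ E] [CompleteSpace E]
    [CStarCorrespondence A E]

theorem ip_add_left (x y z : E) : ip (A := A) (x + y) z = ip x z + ip y z := by
  rw [← star_ip, ip_add_right, star_add, star_ip, star_ip]

theorem ip_smul_left (c : ℂ) (x y : E) : ip (A := A) (c • x) y = star c • ip x y := by
  rw [← star_ip, ip_smul_right, star_smul, star_ip]

theorem ip_ract_left (a : A) (x y : E) : ip (A := A) (ract a x) y = star a * ip x y := by
  rw [← star_ip, ip_ract_right, star_mul, star_ip]

variable (A E) in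
/-- The inner product as a sesquilinear map. -/
def ipₛₗ : E →ₗ⋆[ℂ] E →ₗ[ℂ] A :=
  LinearMap.mk₂'ₛₗ _ _ (fun x y => ip x y) ip_add_left ip_smul_left ip_add_right ip_smul_right

theorem ipₛₗ_apply (x y : E) : ipₛₗ A E x y = ip x y := rfl

theorem sum_ip_sum {ι : Type*} [Fintype ι] (ξ : ι → E) (c : ι → A) :
    ∑ i, ∑ j, star (c i) * ip (A := A) (ξ i) (ξ j) * c j
      = ip (∑ i, ract (c i) (ξ i)) (∑ j, ract (c j) (ξ j)) := by
  simp only [← ipₛₗ_apply, map_sum, LinearMap.sum_apply]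
  simp only [ipₛₗ_apply, ip_ract_left, ip_ract_right, mul_assoc]
  rw [Finset.sum_comm]

/-- `⟨y, φ(b) y⟩ ≤ ‖b‖ ⟨y, y⟩` for a positive `b`. -/
theorem ip_lact_le {b : A} (hb : 0 ≤ b) (y : E) :
    0 ≤ (‖b‖ : ℂ) • ip (A := A) y y - ip y (lact b y) := by
  obtain ⟨d, hds, hd⟩ := exists_sub_sq hb
  have h := ip_self_nonneg (A := A) ((Real.sqrt ‖b‖ : ℂ) • y - lact d y)
  have e : ip (A := A) ((Real.sqrt ‖b‖ : ℂ) • y - lact d y) ((Real.sqrt ‖b‖ : ℂ) • y - lact d y)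
      = (‖b‖ : ℂ) • ip y y - ip y (lact b y) := by
    have hb' : lact b y = (2 * Real.sqrt ‖b‖ : ℂ) • lact d y - lact d (lact d y) := by
      have := congrArg (fun a => lact (A := A) a y) hd
      simpa only [map_sub, map_smul, LinearMap.sub_apply, LinearMap.smul_apply, lact_mul] using this
    have hs : (Real.sqrt ‖b‖ : ℂ) * (Real.sqrt ‖b‖ : ℂ) = (‖b‖ : ℂ) := by
      rw [← Complex.ofReal_mul, Real.mul_self_sqrt (norm_nonneg b)]
    rw [hb']
    simp only [← ipₛₗ_apply, map_sub, LinearMap.sub_apply, map_smul, LinearMap.map_smulₛₗ,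
      LinearMap.smul_apply]
    simp only [ipₛₗ_apply, ip_lact_left, hds, Complex.conj_ofReal]
    rw [smul_sub, smul_smul, hs, two_mul, add_smul]
    abel
  rwa [e] at h

/-- The left action is nondegenerate (the correspondence is essential): the vectors `φ(a) x` span
a dense subspace. -/
def IsEssential (A E : Type*) [NonUnitalCStarAlgebra A] [PartialOrder A]
    [StarOrderedRing A] [NormedAddCommGroup E] [NormedSpace ℂ E] [CompleteSpace E]
    [CStarCorrespondence A E] : Prop :=
  (Submodule.span ℂ {y : E | ∃ (a : A) (x : E), y = lact a x}).topologicalClosure = ⊤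

end CStarCorrespondence

open CStarCorrespondence

/-! ### The Hilbert space `E ⊗_σ H` -/

section IntTensor

variable {A : Type*} (E : Type*) [NonUnitalCStarAlgebra A] [PartialOrder A]
    [StarOrderedRing A] [NormedAddCommGroup E] [NormedSpace ℂ E] [CompleteSpace E]
    [CStarCorrespondence A E] {H : Type*} [NormedAddCommGroup H] [InnerProductSpace ℂ H]
    [CompleteSpace H] (σ : A →⋆ₙₐ[ℂ] (H →L[ℂ] H))

/-- The sesquilinear form on `E ⊗ H` with
`⟨ξ ⊗ h, η ⊗ k⟩ = ⟨h, σ(⟨ξ, η⟩) k⟩`. -/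
noncomputable def intForm : (E ⊗[ℂ] H) →ₗ⋆[ℂ] (E ⊗[ℂ] H) →ₗ[ℂ] ℂ :=
  TensorProduct.lift (LinearMap.mk₂'ₛₗ (starRingEnd ℂ) (starRingEnd ℂ)
    (fun (ξ : E) (h : H) => TensorProduct.lift (LinearMap.mk₂ ℂ
      (fun (η : E) (k : H) => ⟪h, σ (ip ξ η) k⟫_ℂ)
      (fun η η' k => by simp [ip_add_right])
      (fun c η k => by simp [ip_smul_right])
      (fun η k k' => by simp)
      (fun c η k => by simp)))
    (fun ξ ξ' h => by ext η k; simp [ip_add_left])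
    (fun c ξ h => by ext η k; simp [ip_smul_left])
    (fun ξ h h' => by ext η k; simp)
    (fun c ξ h => by ext η k; simp [mul_comm]))

theorem intForm_tmul (ξ η : E) (h k : H) :
    intForm E σ (ξ ⊗ₜ h) (η ⊗ₜ k) = ⟪h, σ (ip ξ η) k⟫_ℂ := rfl

theorem intForm_re_nonneg (t : E ⊗[ℂ] H) : 0 ≤ (intForm E σ t t).re := by
  obtain ⟨S, rfl⟩ := TensorProduct.exists_finset t
  rw [← Finset.sum_coe_sort]
  have h := re_sum_inner_nonneg σ (fun i j : S => ip (A := A) i.1.1 j.1.1)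
    (fun i j => star_ip _ _) (fun c => by rw [sum_ip_sum]; exact ip_self_nonneg _)
    (fun i => i.1.2)
  simp only [map_sum, LinearMap.sum_apply, intForm_tmul]
  rw [Finset.sum_comm]
  exact h

theorem intForm_conj_symm (s t : E ⊗[ℂ] H) :
    starRingEnd ℂ (intForm E σ t s) = intForm E σ s t := by
  induction s with
  | zero => simp
  | add x y hx hy => simp only [map_add, LinearMap.add_apply, hx, hy]
  | tmul ξ h =>
    induction t with
    | zero => simp
    | add x y hx hy => simp only [map_add, LinearMap.add_apply, hx, hy]
    | tmul η k =>
      rw [intForm_tmul, intForm_tmul, inner_conj_symm, ← star_ip, map_star,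
        ContinuousLinearMap.star_eq_adjoint, ContinuousLinearMap.adjoint_inner_left]

/-- The algebraic tensor product `E ⊗ H`, to be equipped with the inner product of `E ⊗_σ H`. -/
def PreIntTensor (_σ : A →⋆ₙₐ[ℂ] (H →L[ℂ] H)) : Type _ := E ⊗[ℂ] H

noncomputable instance : AddCommGroup (PreIntTensor E σ) :=
  inferInstanceAs (AddCommGroup (E ⊗[ℂ] H))

noncomputable instance : Module ℂ (PreIntTensor E σ) :=
  inferInstanceAs (Module ℂ (E ⊗[ℂ] H))

/-- The semi-inner product on the algebraic tensor product. -/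
@[reducible]
noncomputable def PreIntTensor.core : PreInnerProductSpace.Core ℂ (PreIntTensor E σ) where
  inner s t := intForm E σ s t
  conj_inner_symm s t := intForm_conj_symm E σ s t
  re_inner_nonneg t := intForm_re_nonneg E σ t
  add_left s t u := LinearMap.map_add₂ (intForm E σ) s t u
  smul_left s t c := LinearMap.map_smulₛₗ₂ (intForm E σ) c s t

noncomputable instance : SeminormedAddCommGroup (PreIntTensor E σ) :=
  InnerProductSpace.Core.toSeminormedAddCommGroup (c := PreIntTensor.core E σ)

noncomputable instance : InnerProductSpace ℂ (PreIntTensor E σ) :=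
  InnerProductSpace.ofCore (PreIntTensor.core E σ)

/-- The Hilbert space `E ⊗_σ H`: the Hausdorff completion of the algebraic tensor product with
respect to `⟨ξ ⊗ h, η ⊗ k⟩ = ⟨h, σ(⟨ξ, η⟩) k⟩`. -/
abbrev IntTensor : Type _ := UniformSpace.Completion (PreIntTensor E σ)

variable {E}

/-- The elementary tensor `ξ ⊗ h` in `E ⊗_σ H`, as a bilinear map. -/
noncomputable def intTmul : E →ₗ[ℂ] H →ₗ[ℂ] IntTensor E σ :=
  (TensorProduct.mk ℂ E H).compr₂
    (UniformSpace.Completion.toComplₗᵢ (𝕜 := ℂ) (E := PreIntTensor E σ)).toLinearMap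

theorem inner_intTmul (ξ η : E) (h k : H) :
    ⟪intTmul σ ξ h, intTmul σ η k⟫_ℂ = ⟪h, σ (ip ξ η) k⟫_ℂ :=
  UniformSpace.Completion.inner_coe (𝕜 := ℂ) (E := PreIntTensor E σ) _ _

/-- The canonical map of the algebraic tensor product into `E ⊗_σ H`. -/
noncomputable def toIntTensor : PreIntTensor E σ →ₗ[ℂ] IntTensor E σ :=
  (UniformSpace.Completion.toComplₗᵢ (𝕜 := ℂ) (E := PreIntTensor E σ)).toLinearMap

theorem denseRange_toIntTensor : DenseRange (toIntTensor (E := E) σ) :=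
  UniformSpace.Completion.denseRange_coe

theorem exists_toIntTensor_eq (t : PreIntTensor E σ) :
    ∃ (n : ℕ) (ξ : Fin n → E) (h : Fin n → H),
      t = ∑ i, (show PreIntTensor E σ from ξ i ⊗ₜ[ℂ] h i) := by
  obtain ⟨S, hS⟩ := TensorProduct.exists_finset (R := ℂ) (M := E) (N := H) t
  refine ⟨S.card, fun i => (S.equivFin.symm i).1.1, fun i => (S.equivFin.symm i).1.2, hS.trans ?_⟩
  rw [Equiv.sum_comp S.equivFin.symm
    (fun i : S => (show PreIntTensor E σ from i.1.1 ⊗ₜ[ℂ] i.1.2))]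
  exact (Finset.sum_coe_sort S (fun i : E × H => (i.1 ⊗ₜ[ℂ] i.2 : E ⊗[ℂ] H))).symm

/-- The linear map `ξ ⊗ h ↦ f ξ h` on the algebraic tensor product. -/
noncomputable def preIntLift {G : Type*} [AddCommGroup G] [Module ℂ G]
    (f : E →ₗ[ℂ] H →ₗ[ℂ] G) : PreIntTensor E σ →ₗ[ℂ] G :=
  TensorProduct.lift f

/-- The bounded operator on `E ⊗_σ H` with `ξ ⊗ h ↦ f ξ h`. (It is bounded in all the cases where
this is used below; the value `0` that `LinearMap.extendOfNorm` takes in the absence of a bound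
plays no role.) -/
noncomputable def intLift {G : Type*} [NormedAddCommGroup G] [NormedSpace ℂ G] [CompleteSpace G]
    (f : E →ₗ[ℂ] H →ₗ[ℂ] G) : IntTensor E σ →L[ℂ] G :=
  (preIntLift σ f).extendOfNorm (toIntTensor σ)

theorem intTensor_clm_ext {G : Type*} [NormedAddCommGroup G] [NormedSpace ℂ G]
    {S T : IntTensor E σ →L[ℂ] G} (h : ∀ ξ k, S (intTmul σ ξ k) = T (intTmul σ ξ k)) : S = T := by
  refine ContinuousLinearMap.ext fun z => congrFun (DenseRange.equalizer
    (denseRange_toIntTensor (E := E) σ) S.continuous T.continuous (funext fun t => ?_)) z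
  obtain ⟨n, ξ, k, rfl⟩ := exists_toIntTensor_eq σ t
  rw [Function.comp_apply, Function.comp_apply, map_sum, map_sum, map_sum]
  exact Finset.sum_congr rfl fun i _ => h (ξ i) (k i)

theorem intLift_tmul {G : Type*} [NormedAddCommGroup G] [NormedSpace ℂ G] [CompleteSpace G]
    (f : E →ₗ[ℂ] H →ₗ[ℂ] G) (C : ℝ)
    (hC : ∀ (n : ℕ) (ξ : Fin n → E) (h : Fin n → H),
      ‖∑ i, f (ξ i) (h i)‖ ≤ C * ‖∑ i, intTmul σ (ξ i) (h i)‖) (ξ : E) (h : H) :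
    intLift σ f (intTmul σ ξ h) = f ξ h := by
  refine LinearMap.extendOfNorm_eq (f := preIntLift σ f) (denseRange_toIntTensor σ) ⟨C, ?_⟩
    (show PreIntTensor E σ from ξ ⊗ₜ[ℂ] h)
  intro t
  obtain ⟨n, ξ, k, rfl⟩ := exists_toIntTensor_eq σ t
  rw [map_sum, map_sum]
  exact hC n ξ k

theorem norm_sq_sum_intTmul {ι : Type*} [Fintype ι] (ξ : ι → E) (h : ι → H) :
    ‖∑ i, intTmul σ (ξ i) (h i)‖ ^ 2 = (∑ i, ∑ j, ⟪h i, σ (ip (ξ i) (ξ j)) (h j)⟫_ℂ).re := by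
  rw [← inner_self_eq_norm_sq (𝕜 := ℂ)]
  simp only [sum_inner, inner_sum, inner_intTmul]
  rw [Finset.sum_comm]
  rfl

theorem norm_sum_intTmul_le {F : Type*} [NormedAddCommGroup F] [NormedSpace ℂ F] [CompleteSpace F]
    [CStarCorrespondence A F] (R : E → F) (C : ℝ) (hC : 0 ≤ C)
    (hR : ∀ (n : ℕ) (ξ : Fin n → E) (c : Fin n → A),
      0 ≤ ∑ i, ∑ j, star (c i) *
        (((C ^ 2 : ℝ) : ℂ) • ip (ξ i) (ξ j) - ip (R (ξ i)) (R (ξ j))) * c j)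
    (n : ℕ) (ξ : Fin n → E) (h : Fin n → H) :
    ‖∑ i, intTmul σ (R (ξ i)) (h i)‖ ≤ C * ‖∑ i, intTmul σ (ξ i) (h i)‖ := by
  refine le_of_sq_le_sq ?_ (by positivity)
  rw [mul_pow, norm_sq_sum_intTmul, norm_sq_sum_intTmul]
  have := re_sum_inner_nonneg σ
    (fun i j => ((C ^ 2 : ℝ) : ℂ) • ip (A := A) (ξ i) (ξ j) - ip (R (ξ i)) (R (ξ j)))
    (fun i j => by simp [star_ip]) (hR n ξ) h
  simp only [map_sub, map_smul, sub_apply, smul_apply,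
    inner_sub_right, inner_smul_right, Finset.sum_sub_distrib, ← Finset.mul_sum, Complex.sub_re,
    Complex.re_ofReal_mul] at this
  linarith

end IntTensor

/-! ### Product systems over `ℤ₊ᵏ` -/

/-- A product system over `ℤ₊ᵏ` of C*-correspondences `X n` over `A`, with an associative
multiplication `X p × X m → X (p + m)`. (The multiplication is indexed by `q` together with a proof
of `p + m = q`.) For nonzero `p`, `m`, the map `(x, y) ↦ xy` extends to an isomorphism of
correspondences from the internal tensor product `X p ⊗_A X m` onto `X (p + m)`: by `ip_mul` it
preserves the inner product of `X p ⊗_A X m`, i.e.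
`⟨x ⊗ y, x' ⊗ y'⟩ = ⟨y, φ(⟨x, x'⟩) y'⟩`, and by `dense_mul` it is onto. (For `p = 0` or `m = 0`,
`ip_mul` follows from the other axioms.) `X 0` is identified with `A`, and the multiplications by
`X 0` are the left and the right action of `A`. -/
structure ProductSystem (A : Type*) [NonUnitalCStarAlgebra A] [PartialOrder A]
    [StarOrderedRing A] {k : ℕ} (X : (Fin k → ℕ) → Type*) [∀ n, NormedAddCommGroup (X n)]
    [∀ n, NormedSpace ℂ (X n)] [∀ n, CompleteSpace (X n)] [∀ n, CStarCorrespondence A (X n)] where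
  /-- The multiplication. -/
  mul : ∀ {p m q : Fin k → ℕ}, p + m = q → X p →ₗ[ℂ] X m →ₗ[ℂ] X q
  mul_assoc : ∀ {p m r pm mr q : Fin k → ℕ} (h₁ : p + m = pm) (h₂ : pm + r = q) (h₃ : m + r = mr)
    (h₄ : p + mr = q) (x : X p) (y : X m) (z : X r),
    mul h₂ (mul h₁ x y) z = mul h₄ x (mul h₃ y z)
  ip_mul : ∀ {p m q : Fin k → ℕ} (h : p + m = q) (x x' : X p) (y y' : X m),
    ip (A := A) (mul h x y) (mul h x' y') = ip y (lact (ip (A := A) x x') y')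
  dense_mul : ∀ {p m q : Fin k → ℕ} (h : p + m = q), p ≠ 0 → m ≠ 0 →
    (Submodule.span ℂ {z : X q | ∃ (x : X p) (y : X m), z = mul h x y}).topologicalClosure = ⊤
  /-- The identification of `X 0` with the correspondence `A`. -/
  unit : X 0 ≃ₗ[ℂ] A
  ip_unit : ∀ x y : X 0, ip (A := A) x y = star (unit x) * unit y
  unit_lact : ∀ (a : A) (x : X 0), unit (lact a x) = a * unit x
  unit_ract : ∀ (a : A) (x : X 0), unit (ract a x) = unit x * a
  unit_mul : ∀ {m : Fin k → ℕ} (h : 0 + m = m) (a : X 0) (y : X m), mul h a y = lact (unit a) y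
  mul_unit : ∀ {p : Fin k → ℕ} (h : p + 0 = p) (x : X p) (a : X 0), mul h x a = ract (unit a) x

/-- The multi-index `e(u) = ∑ i ∈ u, e_i`. -/
def eSet {k : ℕ} (u : Finset (Fin k)) : Fin k → ℕ := ∑ i ∈ u, Pi.single i 1

/-- The multi-index `e_i`. -/
def eIdx {k : ℕ} (i : Fin k) : Fin k → ℕ := Pi.single i 1

namespace ProductSystem

variable {A : Type*} [NonUnitalCStarAlgebra A] [PartialOrder A]
    [StarOrderedRing A] {k : ℕ} {X : (Fin k → ℕ) → Type*} [∀ n, NormedAddCommGroup (X n)]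
    [∀ n, NormedSpace ℂ (X n)] [∀ n, CompleteSpace (X n)] [∀ n, CStarCorrespondence A (X n)]
    (P : ProductSystem A X) {H : Type*} [NormedAddCommGroup H] [InnerProductSpace ℂ H]
    [CompleteSpace H] (σ : A →⋆ₙₐ[ℂ] (H →L[ℂ] H)) {p m q : Fin k → ℕ}

theorem mul_ract (h : p + m = q) (x : X p) (y : X m) (a : A) :
    P.mul h x (ract a y) = ract a (P.mul h x y) := by
  obtain ⟨b, rfl⟩ := P.unit.surjective a
  rw [← P.mul_unit (add_zero m), ← P.mul_unit (add_zero q),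
    P.mul_assoc h (add_zero q) (add_zero m) h]

theorem ip_self_mul_le (h : p + m = q) (x : X p) (y : X m) :
    0 ≤ ((‖x‖ ^ 2 : ℝ) : ℂ) • ip (A := A) y y - ip (P.mul h x y) (P.mul h x y) := by
  rw [P.ip_mul, norm_sq_eq (A := A)]
  exact ip_lact_le (ip_self_nonneg x) y

theorem norm_sum_mul_le (h : p + m = q) (x : X p) (n : ℕ) (y : Fin n → X m) (k : Fin n → H) :
    ‖∑ i, intTmul σ (P.mul h x (y i)) (k i)‖ ≤ ‖x‖ * ‖∑ i, intTmul σ (y i) (k i)‖ := by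
  refine norm_sum_intTmul_le σ (fun y => P.mul h x y) ‖x‖ (norm_nonneg x) (fun n ξ c => ?_) n y k
  simp only [mul_sub, sub_mul, Finset.sum_sub_distrib, mul_smul_comm, smul_mul_assoc,
    ← Finset.smul_sum, sum_ip_sum]
  have := P.ip_self_mul_le h x (∑ i, ract (c i) (ξ i))
  simpa only [map_sum, mul_ract] using this

/-- The creation operator `L_x : X m ⊗_σ H → X (p + m) ⊗_σ H`, `y ⊗ h ↦ xy ⊗ h`, for a fixed
`x ∈ X p`. -/
noncomputable def creationAux (h : p + m = q) (x : X p) :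
    IntTensor (X m) σ →L[ℂ] IntTensor (X q) σ :=
  intLift σ ((intTmul σ).comp (P.mul h x))

theorem creationAux_tmul (h : p + m = q) (x : X p) (y : X m) (k : H) :
    P.creationAux σ h x (intTmul σ y k) = intTmul σ (P.mul h x y) k :=
  intLift_tmul σ _ ‖x‖ (P.norm_sum_mul_le σ h x) y k

/-- The creation operators `L_x`, as a linear function of `x ∈ X p`. With the identification of
`X p ⊗ (X m ⊗_σ H)` and `X (p + m) ⊗_σ H`, the vector `L_x z` is `x ⊗ z`. -/
noncomputable def creation (h : p + m = q) :
    X p →ₗ[ℂ] (IntTensor (X m) σ →L[ℂ] IntTensor (X q) σ) where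
  toFun x := P.creationAux σ h x
  map_add' x x' := intTensor_clm_ext σ fun y k => by simp [creationAux_tmul]
  map_smul' c x := intTensor_clm_ext σ fun y k => by simp [creationAux_tmul]

/-- For an operator `S : H → X m ⊗_σ H`, the operator
`I_p ⊗ S : X p ⊗_σ H → X p ⊗ X m ⊗_σ H = X (p + m) ⊗_σ H`, `x ⊗ h ↦ x ⊗ S h`. (It is used for
`S` with `S σ(a) = (φ(a) ⊗ I) S`.) -/
noncomputable def idTensor (h : p + m = q) (S : H →L[ℂ] IntTensor (X m) σ) :
    IntTensor (X p) σ →L[ℂ] IntTensor (X q) σ :=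
  intLift σ (LinearMap.mk₂ ℂ (fun (x : X p) (k : H) => P.creation σ h x (S k))
    (fun x x' k => by simp) (fun c x k => by simp) (fun x k k' => by simp) (fun c x k => by simp))

end ProductSystem

/-! ### Completely contractive representations -/

/-- Complete contractivity of a linear map `T : E → B(H)`, for the operator space structure of `E`
(as a corner of its linking algebra): the norm of `[ξ_ij] ∈ M_n(E)` is the square root of the norm
of `[∑_l ⟨ξ_li, ξ_lj⟩] ∈ M_n(A)`. -/
def IsCompletelyContractive (A : Type*) {E : Type*} [NonUnitalCStarAlgebra A] [PartialOrder A]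
    [StarOrderedRing A] [NormedAddCommGroup E] [NormedSpace ℂ E] [CompleteSpace E]
    [CStarCorrespondence A E] {H : Type*} [NormedAddCommGroup H] [InnerProductSpace ℂ H]
    [CompleteSpace H] (T : E →ₗ[ℂ] (H →L[ℂ] H)) : Prop :=
  ∀ (n : ℕ) (ξ : Fin n → Fin n → E),
    ‖(CStarMatrix.ofMatrix (Matrix.of fun i j => T (ξ i j)) :
        CStarMatrix (Fin n) (Fin n) (H →L[ℂ] H))‖ ^ 2 ≤
      ‖(CStarMatrix.ofMatrix (Matrix.of fun i j => ∑ l, ip (A := A) (ξ l i) (ξ l j)) :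
        CStarMatrix (Fin n) (Fin n) A)‖

/-- A representation of the product system on the Hilbert space `H` by completely contractive
covariant maps: a `*`-representation `σ` of `A = X 0` and, for each `n ≠ 0`, a completely
contractive bimodule map `T n : X n → B(H)` such that `T (p + m) (xy) = T p x * T m y`.
(Nondegeneracy of `σ` is a separate condition, see `CCRep.IsNondegenerate`.) -/
structure CCRep {A : Type*} [NonUnitalCStarAlgebra A] [PartialOrder A]
    [StarOrderedRing A] {k : ℕ} {X : (Fin k → ℕ) → Type*} [∀ n, NormedAddCommGroup (X n)]
    [∀ n, NormedSpace ℂ (X n)] [∀ n, CompleteSpace (X n)] [∀ n, CStarCorrespondence A (X n)]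
    (P : ProductSystem A X) (H : Type*) [NormedAddCommGroup H] [InnerProductSpace ℂ H]
    [CompleteSpace H] where
  /-- The representation of `A`. -/
  σ : A →⋆ₙₐ[ℂ] (H →L[ℂ] H)
  /-- The maps `T n : X n → B(H)`. -/
  T : ∀ n : Fin k → ℕ, X n →ₗ[ℂ] (H →L[ℂ] H)
  T_zero : ∀ x : X 0, T 0 x = σ (P.unit x)
  T_lact : ∀ (n : Fin k → ℕ) (a : A) (x : X n), T n (lact a x) = σ a ∘L T n x
  T_ract : ∀ (n : Fin k → ℕ) (a : A) (x : X n), T n (ract a x) = T n x ∘L σ a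
  T_cc : ∀ n : Fin k → ℕ, n ≠ 0 → IsCompletelyContractive A (T n)
  T_mul : ∀ {p m q : Fin k → ℕ} (h : p + m = q) (x : X p) (y : X m),
    T q (P.mul h x y) = T p x ∘L T m y

namespace CCRep

variable {A : Type*} [NonUnitalCStarAlgebra A] [PartialOrder A]
    [StarOrderedRing A] {k : ℕ} {X : (Fin k → ℕ) → Type*} [∀ n, NormedAddCommGroup (X n)]
    [∀ n, NormedSpace ℂ (X n)] [∀ n, CompleteSpace (X n)] [∀ n, CStarCorrespondence A (X n)]
    {P : ProductSystem A X} {H : Type*} [NormedAddCommGroup H] [InnerProductSpace ℂ H]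
    [CompleteSpace H] (R : CCRep P H)

/-- `σ` is nondegenerate: the vectors `σ(a) h` span a dense subspace of `H`. -/
def IsNondegenerate : Prop :=
  (Submodule.span ℂ {h : H | ∃ (a : A) (h' : H), h = R.σ a h'}).topologicalClosure = ⊤

/-- The contraction `T̃_n : X n ⊗_σ H → H`, `x ⊗ h ↦ T_n(x) h`. -/
noncomputable def tilde (n : Fin k → ℕ) : IntTensor (X n) R.σ →L[ℂ] H :=
  intLift R.σ ((ContinuousLinearMap.coeLM ℂ).comp (R.T n))

/-- The operator `I_p ⊗ T̃_m^* : X p ⊗_σ H → X (p + m) ⊗_σ H`. Its adjoint is `I_p ⊗ T̃_m`. -/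
noncomputable def idTensorAdj {p m q : Fin k → ℕ} (h : p + m = q) :
    IntTensor (X p) R.σ →L[ℂ] IntTensor (X q) R.σ :=
  P.idTensor R.σ h (ContinuousLinearMap.adjoint (R.tilde m))

/-- The operator `I_p ⊗ T̃_m : X (p + m) ⊗_σ H → X p ⊗_σ H`, `xy ⊗ h ↦ x ⊗ T_m(y) h`. -/
noncomputable def idTensorTilde {p m q : Fin k → ℕ} (h : p + m = q) :
    IntTensor (X q) R.σ →L[ℂ] IntTensor (X p) R.σ :=
  ContinuousLinearMap.adjoint (R.idTensorAdj h)

open Classical in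
/-- The operator `I_{n - m} ⊗ T̃_m^* T̃_m` on `X n ⊗_σ H`, for `m ≤ n`. -/
noncomputable def idTensorSq (n m : Fin k → ℕ) :
    IntTensor (X n) R.σ →L[ℂ] IntTensor (X n) R.σ :=
  if h : m ≤ n then
    R.idTensorAdj (tsub_add_cancel_of_le h) ∘L R.idTensorTilde (tsub_add_cancel_of_le h)
  else 0

/-- The operator `∑_{u ⊆ v} (-1)^|u| (I_{e(v) - e(u)} ⊗ T̃_{e(u)}^* T̃_{e(u)})` on
`X (e(v)) ⊗_σ H`. -/
noncomputable def defect (v : Finset (Fin k)) :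
    IntTensor (X (eSet v)) R.σ →L[ℂ] IntTensor (X (eSet v)) R.σ :=
  ∑ u ∈ v.powerset, (-1 : ℂ) ^ u.card • R.idTensorSq (eSet v) (eSet u)

/-- The operator `I_{e(v)} ⊗ I_H - I_{e(v) - e_i} ⊗ T̃^{(i)*} T̃^{(i)}` on `X (e(v)) ⊗_σ H`, for
`i ∈ v`. -/
noncomputable def defectFactor (v : Finset (Fin k)) (i : Fin k) :
    IntTensor (X (eSet v)) R.σ →L[ℂ] IntTensor (X (eSet v)) R.σ :=
  1 - R.idTensorSq (eSet v) (eIdx i)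

/-- The operator `T(n) = T̃_{n₋}^* T̃_{n₊} : X n₊ ⊗_σ H → X n₋ ⊗_σ H`, for `n ∈ ℤᵏ`. -/
noncomputable def symbol (n : Fin k → ℤ) :
    IntTensor (X fun i => (n i).toNat) R.σ →L[ℂ] IntTensor (X fun i => (-n i).toNat) R.σ :=
  ContinuousLinearMap.adjoint (R.tilde fun i => (-n i).toNat) ∘L R.tilde fun i => (n i).toNat

/-- The representation is doubly commuting: for `i ≠ j`, as operators `E_i ⊗ H → E_j ⊗ H`,
`T̃^{(j)*} T̃^{(i)} = (I_{e_j} ⊗ T̃^{(i)}) (t_{i,j} ⊗ I_H) (I_{e_i} ⊗ T̃^{(j)*})`. The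
isomorphism `t_{i,j} : E_i ⊗ E_j → E_j ⊗ E_i` is the identity of `X (e_i + e_j)` when both
products are identified with it through the multiplication. -/
def IsDoublyCommuting : Prop :=
  ∀ i j : Fin k, i ≠ j →
    ContinuousLinearMap.adjoint (R.tilde (eIdx j)) ∘L R.tilde (eIdx i) =
      R.idTensorTilde (add_comm (eIdx j) (eIdx i)) ∘L
        R.idTensorAdj (rfl : eIdx i + eIdx j = eIdx i + eIdx j)

end CCRep

section Dilation

variable {A : Type*} [NonUnitalCStarAlgebra A] [PartialOrder A]
    [StarOrderedRing A] {k : ℕ} {X : (Fin k → ℕ) → Type*} [∀ n, NormedAddCommGroup (X n)]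
    [∀ n, NormedSpace ℂ (X n)] [∀ n, CompleteSpace (X n)] [∀ n, CStarCorrespondence A (X n)]
    {P : ProductSystem A X} {H : Type*} [NormedAddCommGroup H] [InnerProductSpace ℂ H]
    [CompleteSpace H] {K : Type*} [NormedAddCommGroup K] [InnerProductSpace ℂ K]
    [CompleteSpace K]

/-- The operator `I ⊗ ι : E ⊗_σ H → E ⊗_ρ K`, `x ⊗ h ↦ x ⊗ ι h`. (It is used for an isometry `ι`
with `ρ(a) ι = ι σ(a)`; it is then the inclusion of `E ⊗ H` in `E ⊗ K`, and its adjoint is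
`I ⊗ P_H`.) -/
noncomputable def idTensorIncl (E : Type*) [NormedAddCommGroup E] [NormedSpace ℂ E]
    [CompleteSpace E] [CStarCorrespondence A E] (σ : A →⋆ₙₐ[ℂ] (H →L[ℂ] H))
    (ρ : A →⋆ₙₐ[ℂ] (K →L[ℂ] K)) (ι : H →ₗᵢ[ℂ] K) : IntTensor E σ →L[ℂ] IntTensor E ρ :=
  intLift σ ((intTmul ρ).compl₂ ι.toLinearMap)

/-- `V`, a representation on `K`, is a regular isometric dilation of `R`, where `H` is regarded as a
closed subspace of `K` through the isometry `ι`. -/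
structure IsRegularIsometricDilation (R : CCRep P H) (V : CCRep P K) (ι : H →ₗᵢ[ℂ] K) : Prop where
  /-- Each `Ṽ^{(i)} : E_i ⊗ K → K` is an isometry. -/
  isometry : ∀ i : Fin k, Isometry (V.tilde (eIdx i))
  /-- `H` is invariant under every `V^{(i)}(ξ)^*`. -/
  invariant : ∀ (i : Fin k) (ξ : X (eIdx i)) (h : H), ∃ h' : H,
    ContinuousLinearMap.adjoint (V.T (eIdx i) ξ) (ι h) = ι h'
  /-- `H` is invariant under `ρ` (hence reducing, as `ρ` is a `*`-representation), and
  `ρ(a)|_H = σ(a)`. -/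
  restrict : ∀ (a : A) (h : H), V.σ a (ι h) = ι (R.σ a h)
  /-- `(I ⊗ P_H) V(n)|_{X n₊ ⊗ H} = T(n)` for every `n ∈ ℤᵏ`. -/
  regular : ∀ n : Fin k → ℤ,
    ContinuousLinearMap.adjoint (idTensorIncl (X fun i => (-n i).toNat) R.σ V.σ ι) ∘L V.symbol n ∘L
      idTensorIncl (X fun i => (n i).toNat) R.σ V.σ ι = R.symbol n

/-- The dilation is minimal: the smallest closed subspace of `K` that contains `H` and is invariant
under all `V^{(i)}(ξ)` is `K`. -/
def IsMinimalDilation (V : CCRep P K) (ι : H →ₗᵢ[ℂ] K) : Prop :=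
  ∀ M : Submodule ℂ K, IsClosed (M : Set K) → (∀ h : H, ι h ∈ M) →
    (∀ (i : Fin k) (ξ : X (eIdx i)), ∀ x ∈ M, V.T (eIdx i) ξ x ∈ M) → M = ⊤

end Dilation

universe uA uX uH uK

/-! ### Completely contractive maps and contractions of `E ⊗_σ H` -/

section Contractions

/-! On `X(n) ⊗ H` put `Q_m = I_{n-m} ⊗ T̃_m^* T̃_m`. Double commutation lets `I ⊗ T̃_i` pass `I ⊗
T̃_j^*` for `i ≠ j`, hence pass `I ⊗ T̃_m^*` whenever `m_i = 0`. This gives `Q_{e_i} Q_m = Q_{e_i +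
m}` for such `m` (`IsDoublyCommuting.idTensorSq_mul`). The right side is self-adjoint, so the two
factors commute, and the alternating sum is the expansion of the product of the `1 - Q_{e_i}`. These
are positive because the `T̃_i` are contractions.

In a minimal regular isometric dilation the vectors `V_n(x) h` span a dense subspace, and their
inner products are forced: with `s = min(n, m)`, `n = s + a`, `m = s + b`, isometry removes the
common part `s` and regularity evaluates the rest, which leaves the kernel `I_s ⊗ T̃_b^* T̃_a`.
`IsKernelFamily` records maps `j_n : X(n) ⊗ H → K` with this Gram kernel and dense span. Such a
family exists because the kernel has an explicit factorization: if `N_r^* N_r` is the alternating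
sum on `X(r) ⊗ H` over the support of `r`, then `Φ_n = ⊕_{r ≤ n} N_r (I_r ⊗ T̃_{n-r})` works, by
Möbius inversion on a box (`sum_Iic_sum_powerset`). The dilation acts on it by the shifts `j_n(z) ↦
j_{p+n}(x ⊗ z)`, which are bounded since the kernel is unchanged by a common shift, and `H` is the
image of `j_0`.

Conversely every minimal regular isometric dilation yields a kernel family (`isKernelFamily_orbit`),
so its properties can be computed there. The projection `Ṽ_j Ṽ_j^*` fixes the range of `j_n` if `n_j
> 0` and maps `j_n(z)` to `j_{n+e_j}((I ⊗ T̃_j^*) z)` if `n_j = 0`. It therefore commutes with every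
`V_i(x)`, `i ≠ j`, and for an isometric representation this gives double commutation.

Two technical points. That `T̃_n` is a contraction is deduced from complete contractivity without a
unit in `A`, through regularised inverse square roots of Gram matrices. And since the left actions
may be degenerate, products `X(0) X(m)` need not be dense in `X(m)`; so factoring `X(q)` as `X(p)
X(m)` requires `p ≠ 0`, and `p = 0` is handled by the unitary `T̃_0 : X(0) ⊗ H → H`, which exists
because `σ` is nondegenerate. -/

theorem exists_gram_factor {A : Type*} [NonUnitalCStarAlgebra A] [PartialOrder A]
    [StarOrderedRing A] {ι : Type*} [Fintype ι] (g : ι → ι → A)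
    (hg : ∀ i j, star (g i j) = g j i)
    (hpos : ∀ c : ι → A, 0 ≤ ∑ i, ∑ j, star (c i) * g i j * c j) :
    ∃ N : ι → ι → A, ∀ i j, g i j = ∑ k, star (N k i) * N k j := by
  have h0 : 0 ≤ (CStarMatrix.ofMatrix (Matrix.of g) : CStarMatrix ι ι A) := by
    refine cstarMatrix_nonneg_of_forall _ ?_ hpos
    ext i j
    exact hg j i
  obtain ⟨N, hN⟩ := exists_star_mul_self_of_nonneg h0
  refine ⟨fun i j => N i j, fun i j => ?_⟩
  have := congrArg (fun M : CStarMatrix ι ι A => M i j) hN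
  simpa [CStarMatrix.mul_apply, CStarMatrix.star_apply] using this

theorem exists_ip_gram_factor {A E : Type*} [NonUnitalCStarAlgebra A] [PartialOrder A]
    [StarOrderedRing A] [NormedAddCommGroup E] [NormedSpace ℂ E] [CompleteSpace E]
    [CStarCorrespondence A E] {ι : Type*} [Fintype ι] (ξ : ι → E) :
    ∃ N : ι → ι → A, ∀ i j, ip (A := A) (ξ i) (ξ j) = ∑ k, star (N k i) * N k j :=
  exists_gram_factor _ (fun _ _ => star_ip _ _)
    (fun c => by rw [sum_ip_sum]; exact ip_self_nonneg _)

/-- For positive `G` and `ε > 0` there are `C`, `S` with `G = S*S`, `‖C*GC‖ ≤ 1` and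
`(1 - CS)* G (1 - CS)` of norm at most `ε`. -/
theorem exists_approx_sqrt_inv {B : Type*} [NonUnitalCStarAlgebra B] [PartialOrder B]
    [StarOrderedRing B] {G : B} (hG : 0 ≤ G) {ε : ℝ} (hε : 0 < ε) :
    ∃ C S : B, G = star S * S ∧ ‖star C * G * C‖ ≤ 1 ∧
      ‖G - star (C * S) * G - G * (C * S) + star (C * S) * G * (C * S)‖ ≤ ε := by
  have hsa : IsSelfAdjoint G := IsSelfAdjoint.of_nonneg hG
  -- `C = f(G)` is a regularised inverse of `S = √G`, so that `CS = G/(G + ε)`. The absolute value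
  -- changes nothing on the spectrum and makes `f` continuous on the whole line.
  let f : ℝ → ℝ := fun t => Real.sqrt t / (|t| + ε)
  let s : ℝ → ℝ := fun t => Real.sqrt t
  have hne : ∀ t : ℝ, |t| + ε ≠ 0 := fun t => by positivity
  have hf0 : f 0 = 0 := by simp [f]
  have hs0 : s 0 = 0 := by simp [s]
  have hfc : Continuous f := by fun_prop (disch := exact hne _)
  have hsc : Continuous s := by fun_prop
  have hfa : star (cfcₙ f G) = cfcₙ f G := (cfcₙ_predicate f G : IsSelfAdjoint _).star_eq
  have hss : star (cfcₙ s G) = cfcₙ s G := (cfcₙ_predicate s G : IsSelfAdjoint _).star_eq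
  have hspec : ∀ t ∈ quasispectrum ℝ G, 0 ≤ t := fun t ht =>
    quasispectrum_nonneg_of_nonneg G hG t ht
  have hmul : cfcₙ f G * cfcₙ s G = cfcₙ (fun t => f t * s t) G := (cfcₙ_mul f s G).symm
  have hds : star (cfcₙ (fun t => f t * s t) G) = cfcₙ (fun t => f t * s t) G :=
    (cfcₙ_predicate _ G : IsSelfAdjoint _).star_eq
  have hG' : cfcₙ (fun t : ℝ => t) G = G := cfcₙ_id' ℝ G
  refine ⟨cfcₙ f G, cfcₙ s G, ?_, ?_, ?_⟩
  · rw [hss, ← cfcₙ_mul s s G]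
    conv_lhs => rw [← hG']
    exact cfcₙ_congr fun t ht => (Real.mul_self_sqrt (hspec t ht)).symm
  · rw [hfa]
    nth_rewrite 2 [← hG']
    rw [← cfcₙ_mul f _ G, ← cfcₙ_mul _ f G]
    refine norm_cfcₙ_le fun t ht => ?_
    have ht0 := hspec t ht
    have e : f t * t * f t = (t / (t + ε)) ^ 2 := by
      simp only [f, abs_of_nonneg ht0]
      field_simp
      rw [Real.sq_sqrt ht0, sq]
    rw [e, Real.norm_of_nonneg (by positivity)]
    refine pow_le_one₀ (by positivity) ?_
    rw [div_le_one (by positivity)]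
    linarith
  · rw [hmul, hds]
    set d : ℝ → ℝ := fun t => f t * s t with hd
    have hdc : Continuous d := hfc.mul hsc
    have hd0 : d 0 = 0 := by simp [d, hf0]
    have e : G - cfcₙ d G * G - G * cfcₙ d G + cfcₙ d G * G * cfcₙ d G
        = cfcₙ (fun t => t - d t * t - t * d t + d t * t * d t) G := by
      rw [cfcₙ_add (fun t => t - d t * t - t * d t) (fun t => d t * t * d t) G (by fun_prop)
          (by simp) (by fun_prop) (by simp),
        cfcₙ_sub (fun t => t - d t * t) (fun t => t * d t) G (by fun_prop) (by simp)
          (by fun_prop) (by simp),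
        cfcₙ_sub (fun t => t) (fun t => d t * t) G (by fun_prop) (by simp)
          (by fun_prop) (by simp),
        cfcₙ_mul (fun t => d t * t) d G (by fun_prop) (by simp) (by fun_prop) (by simp [hd0]),
        cfcₙ_mul d (fun t => t) G (by fun_prop) (by simp [hd0]) (by fun_prop) (by simp),
        cfcₙ_mul (fun t => t) d G (by fun_prop) (by simp) (by fun_prop) (by simp [hd0]), hG']
    rw [e]
    refine norm_cfcₙ_le fun t ht => ?_
    have ht0 := hspec t ht
    have h1 := Real.mul_self_sqrt ht0
    have e1 : d t = t / (t + ε) := by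
      simp only [d, f, s, abs_of_nonneg ht0]
      rw [div_mul_eq_mul_div, h1]
    -- The residual is `t (1 - t/(t + ε))²`; the last factor below is at most `1` because `tε ≤ (t +
    -- ε)²`.
    have e2 : t - d t * t - t * d t + d t * t * d t = ε * (t * ε / (t + ε) ^ 2) := by
      rw [e1]
      field_simp
      ring
    rw [e2, Real.norm_of_nonneg (by positivity)]
    refine mul_le_of_le_one_right hε.le ?_
    rw [div_le_one (by positivity)]
    nlinarith

variable {H : Type*} [NormedAddCommGroup H] [InnerProductSpace ℂ H] [CompleteSpace H]

/-- The element `‖M‖² - M*M` is positive in the C*-algebra of operator matrices, hence of the form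
`N*N`, and `N*N` has a nonnegative quadratic form on columns of vectors. This gives the action on
`Hⁿ` without identifying matrices with operators there. -/
theorem sum_norm_sq_cstarMatrix_apply_le {n : ℕ} (M : CStarMatrix (Fin n) (Fin n) (H →L[ℂ] H))
    (h : Fin n → H) : ∑ i, ‖∑ j, M i j (h j)‖ ^ 2 ≤ ‖M‖ ^ 2 * ∑ i, ‖h i‖ ^ 2 := by
  have h0 : 0 ≤ algebraMap ℝ (CStarMatrix (Fin n) (Fin n) (H →L[ℂ] H)) (‖M‖ ^ 2) - star M * M :=
    sub_nonneg.mpr CStarAlgebra.star_mul_le_algebraMap_norm_sq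
  obtain ⟨N, hN⟩ := exists_star_mul_self_of_nonneg h0
  have quad : ∀ L : CStarMatrix (Fin n) (Fin n) (H →L[ℂ] H),
      ∑ i, ∑ j, ⟪h i, (star L * L) i j (h j)⟫_ℂ = ((∑ k, ‖∑ j, L k j (h j)‖ ^ 2 : ℝ) : ℂ) := by
    intro L
    rw [Complex.ofReal_sum]
    have hsq : ∀ x : H, ((‖x‖ ^ 2 : ℝ) : ℂ) = ⟪x, x⟫_ℂ := fun x => by
      rw [inner_self_eq_norm_sq_to_K]; simp
    simp only [hsq, sum_inner, inner_sum, CStarMatrix.mul_apply, CStarMatrix.star_apply,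
      sum_apply, mul_apply_eq_comp,
      ContinuousLinearMap.star_eq_adjoint, ContinuousLinearMap.adjoint_inner_right]
    calc _ = ∑ i, ∑ k, ∑ j, ⟪L k i (h i), L k j (h j)⟫_ℂ :=
          Finset.sum_congr rfl fun i _ => Finset.sum_comm
      _ = ∑ k, ∑ i, ∑ j, ⟪L k i (h i), L k j (h j)⟫_ℂ := Finset.sum_comm
      _ = _ := Finset.sum_congr rfl fun k _ => by
        exact Finset.sum_comm
  have e := quad N
  rw [← hN] at e
  simp only [CStarMatrix.sub_apply, sub_apply, inner_sub_right, Finset.sum_sub_distrib,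
    quad M] at e
  have e2 : ∑ i, ∑ j, ⟪h i, (algebraMap ℝ (CStarMatrix (Fin n) (Fin n) (H →L[ℂ] H))
      (‖M‖ ^ 2)) i j (h j)⟫_ℂ = ((‖M‖ ^ 2 * ∑ i, ‖h i‖ ^ 2 : ℝ) : ℂ) := by
    simp only [Algebra.algebraMap_eq_smul_one, CStarMatrix.smul_apply, CStarMatrix.one_apply]
    simp only [smul_ite, smul_zero]
    have : ∀ i j, ⟪h i, (if i = j then (‖M‖ ^ 2) • (1 : H →L[ℂ] H) else 0) (h j)⟫_ℂ
        = if i = j then ((‖M‖ ^ 2 * ‖h i‖ ^ 2 : ℝ) : ℂ) else 0 := by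
      intro i j
      split_ifs with hij
      · subst hij
        simp [inner_smul_right_eq_smul, inner_self_eq_norm_sq_to_K]
      · simp
    simp only [this]
    simp [Finset.mul_sum]
  rw [e2, ← Complex.ofReal_sub, Complex.ofReal_inj] at e
  have : 0 ≤ ∑ k, ‖∑ j, N k j (h j)‖ ^ 2 := by positivity
  linarith

end Contractions

/-! ### Passing between complete contractivity and contractivity on `E ⊗_σ H` -/

section Contractions

theorem ofReal_norm_sq_eq_inner {H : Type*} [NormedAddCommGroup H] [InnerProductSpace ℂ H]
    (x : H) : ((‖x‖ ^ 2 : ℝ) : ℂ) = ⟪x, x⟫_ℂ := by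
  rw [inner_self_eq_norm_sq_to_K]; simp

variable {A E : Type*} [NonUnitalCStarAlgebra A] [PartialOrder A]
    [StarOrderedRing A] [NormedAddCommGroup E] [NormedSpace ℂ E] [CompleteSpace E]
    [CStarCorrespondence A E] {H : Type*} [NormedAddCommGroup H] [InnerProductSpace ℂ H]
    [CompleteSpace H]

theorem IsCompletelyContractive.norm_sum_sq_le {T : E →ₗ[ℂ] (H →L[ℂ] H)}
    (hT : IsCompletelyContractive A T) {n : ℕ} (ξ : Fin n → E) (h : Fin n → H) :
    ‖∑ i, T (ξ i) (h i)‖ ^ 2 ≤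
      ‖(CStarMatrix.ofMatrix (Matrix.of fun i j => ip (A := A) (ξ i) (ξ j)) :
        CStarMatrix (Fin n) (Fin n) A)‖ * ∑ i, ‖h i‖ ^ 2 := by
  cases n with
  | zero => simp
  | succ n =>
    -- The row `ξ` is completed by zero rows to a square matrix; its Gram matrix of columns is still
    -- `[⟨ξ_i, ξ_j⟩]`.
    let ζ : Fin (n + 1) → Fin (n + 1) → E := fun i j => if i = 0 then ξ j else 0
    have h1 := sum_norm_sq_cstarMatrix_apply_le
      (CStarMatrix.ofMatrix (Matrix.of fun i j => T (ζ i j))) h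
    have h2 := hT (n + 1) ζ
    have e : ∀ i j, ∑ l, ip (A := A) (ζ l i) (ζ l j) = ip (ξ i) (ξ j) := by
      intro i j
      rw [Finset.sum_eq_single 0]
      · simp [ζ]
      · intro l _ hl
        simp only [ζ, hl, if_false]
        rw [← ipₛₗ_apply, map_zero]
      · simp
    simp only [e] at h2
    have h3 : ‖∑ j, T (ξ j) (h j)‖ ^ 2 ≤
        ∑ i, ‖∑ j, (CStarMatrix.ofMatrix (Matrix.of fun i j => T (ζ i j))) i j (h j)‖ ^ 2 := by
      have := Finset.single_le_sum (s := Finset.univ) (f := fun i =>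
        ‖∑ j, (CStarMatrix.ofMatrix (Matrix.of fun i j => T (ζ i j))) i j (h j)‖ ^ 2)
        (fun i _ => by positivity) (Finset.mem_univ 0)
      refine le_trans (le_of_eq ?_) this
      simp [ζ]
    exact h3.trans (h1.trans (by gcongr))

/-- A completely contractive right module map `T` induces a contraction `E ⊗_σ H → H`. -/
theorem IsCompletelyContractive.norm_sum_apply_le {σ : A →⋆ₙₐ[ℂ] (H →L[ℂ] H)}
    {T : E →ₗ[ℂ] (H →L[ℂ] H)} (hT : IsCompletelyContractive A T)
    (hσ : ∀ (a : A) (x : E), T (ract a x) = T x ∘L σ a) {n : ℕ} (ξ : Fin n → E) (h : Fin n → H) :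
    ‖∑ i, T (ξ i) (h i)‖ ≤ ‖∑ i, intTmul σ (ξ i) (h i)‖ := by
  have key : ∀ ε : ℝ, 0 < ε → ‖∑ i, T (ξ i) (h i)‖ ≤
      ‖∑ i, intTmul σ (ξ i) (h i)‖ + Real.sqrt (ε * ∑ i, ‖h i‖ ^ 2) := by
    intro ε hε
    have hG : 0 ≤ (CStarMatrix.ofMatrix (Matrix.of fun i j => ip (A := A) (ξ i) (ξ j)) :
        CStarMatrix (Fin n) (Fin n) A) := by
      refine cstarMatrix_nonneg_of_forall _ ?_ fun c => ?_
      · ext i j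
        exact star_ip _ _
      · exact (sum_ip_sum ξ c).symm ▸ ip_self_nonneg _
    -- Put `η = ξC`, `g = σ(S)h`, `D = CS`. The module property gives `∑ T(η_j) g_j = ∑ T((ξD)_j)
    -- h_j`; the Gram matrix of `η` is `C*GC`, of norm at most `1`, and `‖g‖` equals the norm of `∑
    -- ξ_i ⊗ h_i` since `G = S*S`. The error comes from `δ = ξ(1 - D)`, whose Gram matrix has norm
    -- at most `ε`.
    obtain ⟨C, S, hS, hC, hd⟩ := exists_approx_sqrt_inv hG hε
    have gram : ∀ M N : CStarMatrix (Fin n) (Fin n) A,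
        (star M * (CStarMatrix.ofMatrix (Matrix.of fun i j => ip (A := A) (ξ i) (ξ j)) :
          CStarMatrix (Fin n) (Fin n) A) * N) =
        CStarMatrix.ofMatrix (Matrix.of fun i j =>
          ip (A := A) (∑ l, ract (M l i) (ξ l)) (∑ l, ract (N l j) (ξ l))) := by
      intro M N
      ext i j
      simp only [CStarMatrix.mul_apply, CStarMatrix.star_apply, CStarMatrix.ofMatrix_apply,
        Matrix.of_apply, Finset.sum_mul]
      simp only [← ipₛₗ_apply, map_sum, LinearMap.sum_apply]
      simp only [ipₛₗ_apply, ip_ract_left, ip_ract_right, mul_assoc]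
    obtain ⟨D, hD⟩ : ∃ D : CStarMatrix (Fin n) (Fin n) A, D = C * S := ⟨_, rfl⟩
    rw [← hD] at hd
    let η : Fin n → E := fun j => ∑ l, ract (C l j) (ξ l)
    let g : Fin n → H := fun i => ∑ j, σ (S i j) (h j)
    let δ : Fin n → E := fun j => ξ j - ∑ l, ract (D l j) (ξ l)
    have e1 : ∑ j, T (η j) (g j) = ∑ j, T (∑ l, ract (D l j) (ξ l)) (h j) := by
      simp only [η, g, hD, map_sum, sum_apply, LinearMap.sum_apply, hσ,
        CStarMatrix.mul_apply, map_mul,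
        ContinuousLinearMap.comp_apply, mul_apply_eq_comp]
      calc _ = ∑ k, ∑ j, ∑ l, T (ξ l) (σ (C l k) (σ (S k j) (h j))) := by
            refine Finset.sum_congr rfl fun k _ => ?_
            rw [Finset.sum_comm]
        _ = ∑ j, ∑ k, ∑ l, T (ξ l) (σ (C l k) (σ (S k j) (h j))) := Finset.sum_comm
        _ = _ := Finset.sum_congr rfl fun j _ => Finset.sum_comm
    have e2 : ∑ i, T (ξ i) (h i) = ∑ j, T (η j) (g j) + ∑ j, T (δ j) (h j) := by
      rw [e1, ← Finset.sum_add_distrib]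
      refine Finset.sum_congr rfl fun j _ => ?_
      simp only [δ, map_sub, sub_apply]
      abel
    have n1 : ‖∑ j, T (η j) (g j)‖ ≤ ‖∑ i, intTmul σ (ξ i) (h i)‖ := by
      refine le_of_sq_le_sq ?_ (norm_nonneg _)
      refine (hT.norm_sum_sq_le η g).trans ?_
      rw [gram] at hC
      refine (mul_le_of_le_one_left (by positivity) hC).trans (le_of_eq ?_)
      rw [norm_sq_sum_intTmul]
      have hent : ∀ i j, ip (A := A) (ξ i) (ξ j) = ∑ k, star (S k i) * S k j := by
        intro i j
        have := congrArg (fun M : CStarMatrix (Fin n) (Fin n) A => M i j) hS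
        simpa [CStarMatrix.mul_apply, CStarMatrix.star_apply] using this
      rw [← Complex.ofReal_inj, Complex.ofReal_sum]
      simp only [ofReal_norm_sq_eq_inner]
      have key : ∑ i, ∑ j, ⟪h i, σ (ip (ξ i) (ξ j)) (h j)⟫_ℂ = ∑ k, ⟪g k, g k⟫_ℂ := by
        simp only [g, hent, map_sum, map_mul, map_star, sum_inner, inner_sum, sum_apply,
          mul_apply_eq_comp, ContinuousLinearMap.star_eq_adjoint,
          ContinuousLinearMap.adjoint_inner_right]
        calc _ = ∑ i, ∑ k, ∑ j, ⟪σ (S k i) (h i), σ (S k j) (h j)⟫_ℂ :=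
              Finset.sum_congr rfl fun i _ => Finset.sum_comm
          _ = ∑ k, ∑ i, ∑ j, ⟪σ (S k i) (h i), σ (S k j) (h j)⟫_ℂ := Finset.sum_comm
          _ = _ := Finset.sum_congr rfl fun k _ => Finset.sum_comm
      rw [key]
      simp only [← ofReal_norm_sq_eq_inner]
      rw [← Complex.ofReal_sum, Complex.ofReal_re]
    have n2 : ‖∑ j, T (δ j) (h j)‖ ≤ Real.sqrt (ε * ∑ i, ‖h i‖ ^ 2) := by
      refine Real.le_sqrt_of_sq_le ?_
      refine (hT.norm_sum_sq_le δ h).trans ?_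
      refine mul_le_mul_of_nonneg_right (le_trans (le_of_eq ?_) hd) (by positivity)
      congr 1
      rw [gram]
      ext i j
      simp only [CStarMatrix.add_apply, CStarMatrix.sub_apply, CStarMatrix.ofMatrix_apply,
        Matrix.of_apply, CStarMatrix.mul_apply, CStarMatrix.star_apply, δ]
      simp only [← ipₛₗ_apply, map_sub, LinearMap.sub_apply, map_sum, LinearMap.sum_apply]
      simp only [ipₛₗ_apply, ip_ract_left, ip_ract_right, Finset.sum_sub_distrib]
     
      abel
    rw [e2]
    exact (norm_add_le _ _).trans (add_le_add n1 n2)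
  have hlim : Filter.Tendsto (fun ε : ℝ => ‖∑ i, intTmul σ (ξ i) (h i)‖ +
      Real.sqrt (ε * ∑ i, ‖h i‖ ^ 2)) (nhdsWithin 0 (Set.Ioi 0))
      (nhds (‖∑ i, intTmul σ (ξ i) (h i)‖)) := by
    have hc : Continuous (fun ε : ℝ => ‖∑ i, intTmul σ (ξ i) (h i)‖ +
      Real.sqrt (ε * ∑ i, ‖h i‖ ^ 2)) := by fun_prop
    have := (hc.tendsto 0).mono_left (nhdsWithin_le_nhds (s := Set.Ioi 0))
    simpa using this
  exact ge_of_tendsto hlim (Filter.eventually_of_mem self_mem_nhdsWithin fun ε hε => key ε hε)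

/-- Compressing `σ(G) - M*M` by a column of operators `c` and evaluating at `x` gives a sum over the
rows `l` of `‖∑ ξ_li ⊗ c_i x‖² - ‖∑ T(ξ_li) c_i x‖²`, nonnegative by hypothesis. So `M*M ≤ σ(G)`,
and `σ` is contractive on matrices. -/
theorem isCompletelyContractive_of_norm_sum_le {σ : A →⋆ₙₐ[ℂ] (H →L[ℂ] H)}
    {T : E →ₗ[ℂ] (H →L[ℂ] H)} (hT : ∀ (n : ℕ) (ξ : Fin n → E) (h : Fin n → H),
      ‖∑ i, T (ξ i) (h i)‖ ≤ ‖∑ i, intTmul σ (ξ i) (h i)‖) : IsCompletelyContractive A T := by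
  intro n ξ
  let M : CStarMatrix (Fin n) (Fin n) (H →L[ℂ] H) :=
    CStarMatrix.ofMatrix (Matrix.of fun i j => T (ξ i j))
  let G : CStarMatrix (Fin n) (Fin n) A :=
    CStarMatrix.ofMatrix (Matrix.of fun i j => ∑ l, ip (A := A) (ξ l i) (ξ l j))
  let G' : CStarMatrix (Fin n) (Fin n) (H →L[ℂ] H) := CStarMatrix.mapₙₐ σ G
  have hG' : ∀ i j, G' i j = ∑ l, σ (ip (ξ l i) (ξ l j)) := fun i j => by
    simp [G', G, CStarMatrix.mapₗ_apply, map_sum]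
  have h1 : ‖G'‖ ≤ ‖G‖ := NonUnitalStarAlgHom.norm_apply_le _ G
  have h2 : 0 ≤ G' - star M * M := by
    have hGs : star G' = G' := by
      ext i j
      rw [CStarMatrix.star_apply, hG', hG', star_sum]
      simp only [← map_star, star_ip]
    refine cstarMatrix_nonneg_of_forall _ ?_ fun c => ?_
    · rw [IsSelfAdjoint, star_sub, hGs, star_mul, star_star]
    · rw [ContinuousLinearMap.nonneg_iff_isPositive, ContinuousLinearMap.isPositive_iff_complex]
      intro x
      have e : ⟪x, (∑ i, ∑ j, star (c i) * (G' - star M * M) i j * c j) x⟫_ℂ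
          = ((∑ l, (‖∑ i, intTmul σ (ξ l i) (c i x)‖ ^ 2 - ‖∑ i, T (ξ l i) (c i x)‖ ^ 2) : ℝ)
            : ℂ) := by
        have e1 : ∀ i j, ⟪x, (star (c i) * (G' - star M * M) i j * c j) x⟫_ℂ
            = ∑ l, (⟪intTmul σ (ξ l i) (c i x), intTmul σ (ξ l j) (c j x)⟫_ℂ
              - ⟪T (ξ l i) (c i x), T (ξ l j) (c j x)⟫_ℂ) := by
          intro i j
          rw [CStarMatrix.sub_apply, hG', CStarMatrix.mul_apply]
          simp only [mul_apply_eq_comp, ContinuousLinearMap.star_eq_adjoint,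
            ContinuousLinearMap.adjoint_inner_right, sub_apply, inner_sub_right, sum_apply,
            inner_sum, inner_intTmul, CStarMatrix.star_apply, Finset.sum_sub_distrib]
          rfl
        simp only [sum_apply, inner_sum, e1]
        rw [Complex.ofReal_sum]
        simp only [Complex.ofReal_sub, ofReal_norm_sq_eq_inner, sum_inner, inner_sum,
          ← Finset.sum_sub_distrib]
        calc _ = ∑ i, ∑ l, ∑ j, (⟪intTmul σ (ξ l i) (c i x), intTmul σ (ξ l j) (c j x)⟫_ℂ
              - ⟪T (ξ l i) (c i x), T (ξ l j) (c j x)⟫_ℂ) :=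
              Finset.sum_congr rfl fun i _ => Finset.sum_comm
          _ = ∑ l, ∑ i, ∑ j, (⟪intTmul σ (ξ l i) (c i x), intTmul σ (ξ l j) (c j x)⟫_ℂ
              - ⟪T (ξ l i) (c i x), T (ξ l j) (c j x)⟫_ℂ) := Finset.sum_comm
          _ = _ := Finset.sum_congr rfl fun l _ => Finset.sum_comm
      rw [← inner_conj_symm, e, Complex.conj_ofReal]
      rw [RCLike.re_to_complex, Complex.ofReal_re]
      refine ⟨rfl, ?_⟩
      refine Finset.sum_nonneg fun l _ => ?_
      have := hT n (ξ l) (fun i => c i x)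
      have := pow_le_pow_left₀ (norm_nonneg _) this 2
      linarith
  have h3 : ‖star M * M‖ ≤ ‖G'‖ :=
    CStarAlgebra.norm_le_norm_of_nonneg_of_le (star_mul_self_nonneg M) (sub_nonneg.mp h2)
  have h4 : ‖star M * M‖ = ‖M‖ * ‖M‖ := CStarRing.norm_star_mul_self
  rw [h4, ← sq] at h3
  exact h3.trans h1

theorem intLift_tmul_norm_le {σ : A →⋆ₙₐ[ℂ] (H →L[ℂ] H)} {G : Type*} [NormedAddCommGroup G]
    [NormedSpace ℂ G] [CompleteSpace G] (f : E →ₗ[ℂ] H →ₗ[ℂ] G) (C : ℝ)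
    (hC : ∀ (n : ℕ) (ξ : Fin n → E) (h : Fin n → H),
      ‖∑ i, f (ξ i) (h i)‖ ≤ C * ‖∑ i, intTmul σ (ξ i) (h i)‖) (z : IntTensor E σ) :
    ‖intLift σ f z‖ ≤ C * ‖z‖ := by
  refine LinearMap.norm_extendOfNorm_apply_le (f := preIntLift σ f) (denseRange_toIntTensor σ) C
    ?_ z
  intro t
  obtain ⟨n, ξ, k, rfl⟩ := exists_toIntTensor_eq σ t
  rw [map_sum, map_sum]
  exact hC n ξ k

end Contractions

/-! ### Creation operators and the operators `I ⊗ T̃` -/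

section IntTensorAux

variable {A E : Type*} [NonUnitalCStarAlgebra A] [PartialOrder A]
    [StarOrderedRing A] [NormedAddCommGroup E] [NormedSpace ℂ E] [CompleteSpace E]
    [CStarCorrespondence A E] {H : Type*} [NormedAddCommGroup H] [InnerProductSpace ℂ H]
    [CompleteSpace H] (σ : A →⋆ₙₐ[ℂ] (H →L[ℂ] H))

theorem norm_intTmul_le (x : E) (k : H) : ‖intTmul σ x k‖ ≤ ‖x‖ * ‖k‖ := by
  refine le_of_sq_le_sq ?_ (by positivity)
  rw [← inner_self_eq_norm_sq (𝕜 := ℂ), inner_intTmul, mul_pow, norm_sq_eq (A := A)]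
  calc _ ≤ ‖⟪k, σ (ip x x) k⟫_ℂ‖ := RCLike.re_le_norm _
    _ ≤ ‖k‖ * ‖σ (ip x x) k‖ := norm_inner_le_norm _ _
    _ ≤ ‖k‖ * (‖σ (ip x x)‖ * ‖k‖) := by gcongr; exact ContinuousLinearMap.le_opNorm _ _
    _ ≤ ‖k‖ * (‖ip (A := A) x x‖ * ‖k‖) := by
        gcongr; exact NonUnitalStarAlgHom.norm_apply_le σ _
    _ = _ := by ring

theorem continuous_intTmul_right (x : E) : Continuous fun k : H => intTmul σ x k :=
  ((intTmul σ x).mkContinuous ‖x‖ (norm_intTmul_le σ x)).continuous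

theorem continuous_intTmul_left (k : H) : Continuous fun x : E => intTmul σ x k :=
  (((intTmul σ).flip k).mkContinuous ‖k‖ fun x => by
    rw [mul_comm]; exact norm_intTmul_le σ x k).continuous

variable {σ} in
theorem intTensor_ext_inner {z w : IntTensor E σ}
    (h : ∀ x k, ⟪intTmul σ x k, z⟫_ℂ = ⟪intTmul σ x k, w⟫_ℂ) : z = w := by
  have : innerSL ℂ z = innerSL ℂ w := intTensor_clm_ext σ fun x k => by
    rw [innerSL_apply_apply, innerSL_apply_apply, ← inner_conj_symm, h, inner_conj_symm]
  refine ext_inner_right ℂ fun v => ?_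
  rw [← innerSL_apply_apply, this, innerSL_apply_apply]

end IntTensorAux

namespace ProductSystem

variable {A : Type*} [NonUnitalCStarAlgebra A] [PartialOrder A]
    [StarOrderedRing A] {k : ℕ} {X : (Fin k → ℕ) → Type*} [∀ n, NormedAddCommGroup (X n)]
    [∀ n, NormedSpace ℂ (X n)] [∀ n, CompleteSpace (X n)] [∀ n, CStarCorrespondence A (X n)]
    (P : ProductSystem A X) {H : Type*} [NormedAddCommGroup H] [InnerProductSpace ℂ H]
    [CompleteSpace H] (σ : A →⋆ₙₐ[ℂ] (H →L[ℂ] H)) {p m q : Fin k → ℕ}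

theorem creation_tmul (h : p + m = q) (x : X p) (y : X m) (k : H) :
    P.creation σ h x (intTmul σ y k) = intTmul σ (P.mul h x y) k :=
  P.creationAux_tmul σ h x y k

theorem creation_mul {r pm mr : Fin k → ℕ} (h₁ : p + m = pm) (h₂ : pm + r = q) (h₃ : m + r = mr)
    (h₄ : p + mr = q) (x : X p) (y : X m) (z : IntTensor (X r) σ) :
    P.creation σ h₂ (P.mul h₁ x y) z = P.creation σ h₄ x (P.creation σ h₃ y z) := by
  have : P.creation σ h₂ (P.mul h₁ x y) = P.creation σ h₄ x ∘L P.creation σ h₃ y :=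
    intTensor_clm_ext σ fun w k => by
      simp only [ContinuousLinearMap.comp_apply, creation_tmul, P.mul_assoc h₁ h₂ h₃ h₄]
  rw [this, ContinuousLinearMap.comp_apply]

/-- The operator `φ(a) ⊗ I` on `X m ⊗_σ H`. -/
noncomputable def leftAct (a : A) : IntTensor (X m) σ →L[ℂ] IntTensor (X m) σ :=
  P.creation σ (zero_add m) (P.unit.symm a)

theorem leftAct_tmul (a : A) (y : X m) (k : H) :
    P.leftAct σ a (intTmul σ y k) = intTmul σ (lact a y) k := by
  rw [leftAct, creation_tmul, P.unit_mul, LinearEquiv.apply_symm_apply]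

theorem leftAct_unit (x : X 0) (z : IntTensor (X m) σ) :
    P.leftAct σ (P.unit x) z = P.creation σ (zero_add m) x z := by
  rw [leftAct, LinearEquiv.symm_apply_apply]

theorem leftAct_mul (a b : A) (z : IntTensor (X m) σ) :
    P.leftAct σ (a * b) z = P.leftAct σ a (P.leftAct σ b z) := by
  have : P.leftAct σ (a * b) = P.leftAct σ a ∘L P.leftAct σ (m := m) b :=
    intTensor_clm_ext σ fun w k => by
      simp only [ContinuousLinearMap.comp_apply, leftAct_tmul, lact_mul]
  rw [this, ContinuousLinearMap.comp_apply]

theorem inner_leftAct (a : A) (z w : IntTensor (X m) σ) :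
    ⟪P.leftAct σ a z, w⟫_ℂ = ⟪z, P.leftAct σ (star a) w⟫_ℂ := by
  have : ContinuousLinearMap.adjoint (P.leftAct σ a) = P.leftAct σ (m := m) (star a) :=
    intTensor_clm_ext σ fun y k => intTensor_ext_inner fun x h => by
      rw [ContinuousLinearMap.adjoint_inner_right, leftAct_tmul, leftAct_tmul, inner_intTmul,
        inner_intTmul, ip_lact_left]
  rw [← this, ContinuousLinearMap.adjoint_inner_right]

/-- `L_x^* L_y = φ(⟨x, y⟩) ⊗ I`: on elementary tensors this is the compatibility of the product with
the inner products. -/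
theorem inner_creation (h : p + m = q) (x y : X p) (z w : IntTensor (X m) σ) :
    ⟪P.creation σ h x z, P.creation σ h y w⟫_ℂ = ⟪z, P.leftAct σ (ip x y) w⟫_ℂ := by
  have : ContinuousLinearMap.adjoint (P.creation σ h x) ∘L P.creation σ h y =
      P.leftAct σ (ip x y) :=
    intTensor_clm_ext σ fun y' k => intTensor_ext_inner fun x' h => by
      rw [ContinuousLinearMap.comp_apply, ContinuousLinearMap.adjoint_inner_right, creation_tmul,
        creation_tmul, leftAct_tmul, inner_intTmul, inner_intTmul, P.ip_mul]
  rw [← this, ContinuousLinearMap.comp_apply, ContinuousLinearMap.adjoint_inner_right]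

theorem leftAct_creation (h : p + m = q) (a : A) (x : X p) (z : IntTensor (X m) σ) :
    P.leftAct σ a (P.creation σ h x z) = P.creation σ h (lact a x) z := by
  rw [leftAct, ← P.creation_mul σ (zero_add p) h h (zero_add q), P.unit_mul,
    LinearEquiv.apply_symm_apply]

theorem creation_leftAct (h : p + m = q) (a : A) (x : X p) (z : IntTensor (X m) σ) :
    P.creation σ h x (P.leftAct σ a z) = P.creation σ h (ract a x) z := by
  rw [leftAct, ← P.creation_mul σ (add_zero p) h (zero_add m) h, P.mul_unit,
    LinearEquiv.apply_symm_apply]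

variable {σ} in
-- Factor the Gram matrix of the `x_i` as `N*N`. Since `S` intertwines the actions of `A`, the two
-- squared norms become `∑_l ‖S k_l‖²` and `∑_l ‖k_l‖²` with `k_l = ∑_i σ(N_li) g_i`.
theorem norm_sum_creation_le (h : p + m = q) {S : H →L[ℂ] IntTensor (X m) σ}
    (hS : ∀ a k, S (σ a k) = P.leftAct σ a (S k)) (n : ℕ) (x : Fin n → X p) (g : Fin n → H) :
    ‖∑ i, P.creation σ h (x i) (S (g i))‖ ≤ ‖S‖ * ‖∑ i, intTmul σ (x i) (g i)‖ := by
  obtain ⟨N, hN⟩ := exists_ip_gram_factor (A := A) x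
  have e1 : ((‖∑ i, P.creation σ h (x i) (S (g i))‖ ^ 2 : ℝ) : ℂ)
      = ((∑ l, ‖S (∑ i, σ (N l i) (g i))‖ ^ 2 : ℝ) : ℂ) := by
    rw [Complex.ofReal_sum]
    simp only [ofReal_norm_sq_eq_inner, map_sum, sum_inner, inner_sum, inner_creation, hN]
    have : ∀ i j, ⟪S (g i), P.leftAct σ (∑ l, star (N l i) * N l j) (S (g j))⟫_ℂ
        = ∑ l, ⟪S (σ (N l i) (g i)), S (σ (N l j) (g j))⟫_ℂ := by
      intro i j
      simp only [hS, inner_leftAct, ← leftAct_mul]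
      simp only [leftAct, map_sum, sum_apply, inner_sum]
    simp only [this]
    calc _ = ∑ i, ∑ l, ∑ j, ⟪S (σ (N l j) (g j)), S (σ (N l i) (g i))⟫_ℂ :=
          Finset.sum_congr rfl fun i _ => Finset.sum_comm
      _ = _ := Finset.sum_comm
  have e2 : ((‖∑ i, intTmul σ (x i) (g i)‖ ^ 2 : ℝ) : ℂ)
      = ((∑ l, ‖∑ i, σ (N l i) (g i)‖ ^ 2 : ℝ) : ℂ) := by
    rw [Complex.ofReal_sum]
    simp only [ofReal_norm_sq_eq_inner, sum_inner, inner_sum, inner_intTmul, hN]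
    have : ∀ i j, ⟪g i, σ (∑ l, star (N l i) * N l j) (g j)⟫_ℂ
        = ∑ l, ⟪σ (N l i) (g i), σ (N l j) (g j)⟫_ℂ := by
      intro i j
      simp only [map_sum, map_mul, map_star, sum_apply, mul_apply_eq_comp, inner_sum,
        ContinuousLinearMap.star_eq_adjoint, ContinuousLinearMap.adjoint_inner_right]
    simp only [this]
    calc _ = ∑ i, ∑ l, ∑ j, ⟪σ (N l j) (g j), σ (N l i) (g i)⟫_ℂ :=
          Finset.sum_congr rfl fun i _ => Finset.sum_comm
      _ = _ := Finset.sum_comm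
  rw [Complex.ofReal_inj] at e1 e2
  refine le_of_sq_le_sq ?_ (by positivity)
  rw [mul_pow, e1, e2, Finset.mul_sum]
  refine Finset.sum_le_sum fun l _ => ?_
  rw [← mul_pow]
  exact pow_le_pow_left₀ (norm_nonneg _) (S.le_opNorm _) 2

variable {σ} in
theorem idTensor_tmul (h : p + m = q) {S : H →L[ℂ] IntTensor (X m) σ}
    (hS : ∀ a k, S (σ a k) = P.leftAct σ a (S k)) (x : X p) (g : H) :
    P.idTensor σ h S (intTmul σ x g) = P.creation σ h x (S g) :=
  intLift_tmul σ _ ‖S‖ (P.norm_sum_creation_le h hS) x g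

variable {σ} in
theorem norm_idTensor_le (h : p + m = q) {S : H →L[ℂ] IntTensor (X m) σ}
    (hS : ∀ a k, S (σ a k) = P.leftAct σ a (S k)) : ‖P.idTensor σ h S‖ ≤ ‖S‖ :=
  ContinuousLinearMap.opNorm_le_bound _ S.opNorm_nonneg
    (intLift_tmul_norm_le _ _ (P.norm_sum_creation_le h hS))

end ProductSystem

namespace CCRep

variable {A : Type*} [NonUnitalCStarAlgebra A] [PartialOrder A]
    [StarOrderedRing A] {k : ℕ} {X : (Fin k → ℕ) → Type*} [∀ n, NormedAddCommGroup (X n)]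
    [∀ n, NormedSpace ℂ (X n)] [∀ n, CompleteSpace (X n)] [∀ n, CStarCorrespondence A (X n)]
    {P : ProductSystem A X} {H : Type*} [NormedAddCommGroup H] [InnerProductSpace ℂ H]
    [CompleteSpace H] (R : CCRep P H) {p m q : Fin k → ℕ}

theorem inner_T_zero (x y : X 0) (g h : H) :
    ⟪R.T 0 x g, R.T 0 y h⟫_ℂ = ⟪g, R.σ (ip x y) h⟫_ℂ := by
  rw [R.T_zero, R.T_zero, P.ip_unit, map_mul, map_star, mul_apply_eq_comp,
    ContinuousLinearMap.star_eq_adjoint, ContinuousLinearMap.adjoint_inner_right]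

theorem norm_sum_T_apply_le (n : Fin k → ℕ) (N : ℕ) (ξ : Fin N → X n) (h : Fin N → H) :
    ‖∑ i, R.T n (ξ i) (h i)‖ ≤ 1 * ‖∑ i, intTmul R.σ (ξ i) (h i)‖ := by
  rw [one_mul]
  -- Complete contractivity is an axiom only for `n ≠ 0`; for `n = 0` the map is isometric because
  -- `T_0` is `σ`.
  by_cases hn : n = 0
  · subst hn
    refine le_of_sq_le_sq (le_of_eq ?_) (norm_nonneg _)
    rw [← Complex.ofReal_inj, ofReal_norm_sq_eq_inner, ofReal_norm_sq_eq_inner]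
    simp only [sum_inner, inner_sum, inner_intTmul, inner_T_zero]
  · exact (R.T_cc n hn).norm_sum_apply_le (R.T_ract n) ξ h

theorem tilde_tmul (n : Fin k → ℕ) (x : X n) (h : H) :
    R.tilde n (intTmul R.σ x h) = R.T n x h :=
  intLift_tmul R.σ _ 1 (R.norm_sum_T_apply_le n) x h

theorem norm_tilde_le (n : Fin k → ℕ) : ‖R.tilde n‖ ≤ 1 :=
  ContinuousLinearMap.opNorm_le_bound _ zero_le_one
    (intLift_tmul_norm_le _ _ (R.norm_sum_T_apply_le n))

theorem continuous_T_apply (n : Fin k → ℕ) (h : H) : Continuous fun x => R.T n x h := by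
  have := (R.tilde n).continuous.comp (continuous_intTmul_left R.σ h (E := X n))
  exact this.congr fun x => R.tilde_tmul n x h

theorem tilde_creation (h : p + m = q) (x : X p) (z : IntTensor (X m) R.σ) :
    R.tilde q (P.creation R.σ h x z) = R.T p x (R.tilde m z) := by
  have : R.tilde q ∘L P.creation R.σ h x = R.T p x ∘L R.tilde m :=
    intTensor_clm_ext _ fun y k => by
      simp only [ContinuousLinearMap.comp_apply, P.creation_tmul, tilde_tmul, R.T_mul h]
  exact DFunLike.congr_fun this z

theorem tilde_leftAct (a : A) (z : IntTensor (X m) R.σ) :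
    R.tilde m (P.leftAct R.σ a z) = R.σ a (R.tilde m z) := by
  rw [ProductSystem.leftAct, tilde_creation, R.T_zero, LinearEquiv.apply_symm_apply]

theorem inner_σ_left (a : A) (g h : H) : ⟪R.σ a g, h⟫_ℂ = ⟪g, R.σ (star a) h⟫_ℂ := by
  rw [map_star, ContinuousLinearMap.star_eq_adjoint, ContinuousLinearMap.adjoint_inner_right]

theorem adjoint_tilde_σ (a : A) (h : H) :
    ContinuousLinearMap.adjoint (R.tilde m) (R.σ a h) =
      P.leftAct R.σ a (ContinuousLinearMap.adjoint (R.tilde m) h) := by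
  refine ext_inner_right ℂ fun z => ?_
  rw [ContinuousLinearMap.adjoint_inner_left, P.inner_leftAct,
    ContinuousLinearMap.adjoint_inner_left, tilde_leftAct, inner_σ_left]

theorem idTensorAdj_tmul (h : p + m = q) (x : X p) (g : H) :
    R.idTensorAdj h (intTmul R.σ x g) =
      P.creation R.σ h x (ContinuousLinearMap.adjoint (R.tilde m) g) :=
  P.idTensor_tmul h (fun a k => R.adjoint_tilde_σ a k) x g

theorem norm_idTensorAdj_le (h : p + m = q) : ‖R.idTensorAdj h‖ ≤ 1 :=
  (P.norm_idTensor_le h fun a k => R.adjoint_tilde_σ a k).trans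
    ((ContinuousLinearMap.adjoint.norm_map _).trans_le (R.norm_tilde_le m))

theorem inner_idTensorTilde_left (h : p + m = q) (z : IntTensor (X q) R.σ)
    (w : IntTensor (X p) R.σ) :
    ⟪R.idTensorTilde h z, w⟫_ℂ = ⟪z, R.idTensorAdj h w⟫_ℂ :=
  ContinuousLinearMap.adjoint_inner_left _ _ _

theorem inner_idTensorTilde_right (h : p + m = q) (z : IntTensor (X q) R.σ)
    (w : IntTensor (X p) R.σ) :
    ⟪w, R.idTensorTilde h z⟫_ℂ = ⟪R.idTensorAdj h w, z⟫_ℂ :=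
  ContinuousLinearMap.adjoint_inner_right _ _ _

theorem adjoint_idTensorTilde (h : p + m = q) :
    ContinuousLinearMap.adjoint (R.idTensorTilde h) = R.idTensorAdj h :=
  ContinuousLinearMap.adjoint_adjoint _

/-- `I_p ⊗ T̃_m` is given as an adjoint; pairing with elementary tensors recovers the expected
formula on the vectors `x ⊗ z`. -/
theorem idTensorTilde_creation (h : p + m = q) (x : X p) (z : IntTensor (X m) R.σ) :
    R.idTensorTilde h (P.creation R.σ h x z) = intTmul R.σ x (R.tilde m z) := by
  refine intTensor_ext_inner fun y g => ?_
  rw [inner_idTensorTilde_right, idTensorAdj_tmul, P.inner_creation, inner_intTmul,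
    ContinuousLinearMap.adjoint_inner_left, tilde_leftAct]

theorem idTensorAdj_creation {p' q' r : Fin k → ℕ} (h : p + m = q) (h' : r + p = p')
    (h'' : r + q = q') (h₄ : p' + m = q') (x : X r) (z : IntTensor (X p) R.σ) :
    R.idTensorAdj h₄ (P.creation R.σ h' x z) = P.creation R.σ h'' x (R.idTensorAdj h z) := by
  have : R.idTensorAdj h₄ ∘L P.creation R.σ h' x = P.creation R.σ h'' x ∘L R.idTensorAdj h :=
    intTensor_clm_ext _ fun y k => by
      simp only [ContinuousLinearMap.comp_apply, P.creation_tmul, idTensorAdj_tmul,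
        P.creation_mul R.σ h' h₄ h h'']
  exact DFunLike.congr_fun this z

theorem idTensorAdj_leftAct (h : p + m = q) (a : A) (z : IntTensor (X p) R.σ) :
    R.idTensorAdj h (P.leftAct R.σ a z) = P.leftAct R.σ a (R.idTensorAdj h z) :=
  R.idTensorAdj_creation h _ _ h _ z

theorem idTensorTilde_leftAct (h : p + m = q) (a : A) (z : IntTensor (X q) R.σ) :
    R.idTensorTilde h (P.leftAct R.σ a z) = P.leftAct R.σ a (R.idTensorTilde h z) := by
  refine ext_inner_right ℂ fun w => ?_
  rw [inner_idTensorTilde_left, P.inner_leftAct, P.inner_leftAct, inner_idTensorTilde_left,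
    idTensorAdj_leftAct]

theorem adjoint_tilde_zero_σ (a : A) (h : H) :
    ContinuousLinearMap.adjoint (R.tilde 0) (R.σ a h) = intTmul R.σ (P.unit.symm a) h := by
  refine intTensor_ext_inner fun y g => ?_
  rw [ContinuousLinearMap.adjoint_inner_right, tilde_tmul, inner_intTmul]
  have := R.inner_T_zero y (P.unit.symm a) g h
  rwa [R.T_zero (P.unit.symm a), LinearEquiv.apply_symm_apply] at this

theorem idTensorAdj_zero_add (z : IntTensor (X 0) R.σ) :
    R.idTensorAdj (zero_add m) z = ContinuousLinearMap.adjoint (R.tilde m) (R.tilde 0 z) := by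
  have : R.idTensorAdj (zero_add m) = ContinuousLinearMap.adjoint (R.tilde m) ∘L R.tilde 0 :=
    intTensor_clm_ext _ fun x g => by
      rw [idTensorAdj_tmul, ContinuousLinearMap.comp_apply, tilde_tmul, R.T_zero, adjoint_tilde_σ,
        P.leftAct_unit]
  rw [this, ContinuousLinearMap.comp_apply]

theorem idTensorTilde_zero_add (z : IntTensor (X m) R.σ) :
    R.idTensorTilde (zero_add m) z = ContinuousLinearMap.adjoint (R.tilde 0) (R.tilde m z) := by
  refine ext_inner_right ℂ fun w => ?_
  rw [inner_idTensorTilde_left, idTensorAdj_zero_add, ContinuousLinearMap.adjoint_inner_left,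
    ContinuousLinearMap.adjoint_inner_right]

end CCRep

/-! ### Nondegenerate and doubly commuting representations -/

theorem eIdx_apply {k : ℕ} (i j : Fin k) : eIdx i j = if j = i then 1 else 0 := by
  rw [eIdx, Pi.single_apply]

theorem eIdx_ne_zero {k : ℕ} (i : Fin k) : eIdx i ≠ 0 := fun h => by
  simpa [eIdx_apply] using congrFun h i

theorem exists_eq_eIdx_add {k : ℕ} {n : Fin k → ℕ} {j : Fin k} (hj : n j ≠ 0) :
    ∃ m, n = eIdx j + m := by
  refine ⟨n - eIdx j, (add_tsub_cancel_of_le fun i => ?_).symm⟩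
  rw [eIdx_apply]
  split_ifs with h
  · subst h
    exact Nat.one_le_iff_ne_zero.mpr hj
  · exact Nat.zero_le _

theorem multiIndex_induction {k : ℕ} {motive : (Fin k → ℕ) → Prop} (zero : motive 0)
    (step : ∀ n j, motive n → motive (eIdx j + n)) (n : Fin k → ℕ) : motive n := by
  generalize hN : ∑ i, n i = N
  induction N generalizing n with
  | zero =>
    have : n = 0 := funext fun i => Finset.sum_eq_zero_iff.mp hN i (Finset.mem_univ i)
    exact this ▸ zero
  | succ N ih =>
    obtain ⟨j, -, hj⟩ := Finset.exists_ne_zero_of_sum_ne_zero (hN.trans_ne N.succ_ne_zero)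
    obtain ⟨m, rfl⟩ := exists_eq_eIdx_add hj
    refine step m j (ih m ?_)
    simp only [Pi.add_apply, Finset.sum_add_distrib, eIdx_apply, Finset.sum_ite_eq',
      Finset.mem_univ, if_true] at hN
    omega

namespace CCRep

variable {A : Type*} [NonUnitalCStarAlgebra A] [PartialOrder A]
    [StarOrderedRing A] {k : ℕ} {X : (Fin k → ℕ) → Type*} [∀ n, NormedAddCommGroup (X n)]
    [∀ n, NormedSpace ℂ (X n)] [∀ n, CompleteSpace (X n)] [∀ n, CStarCorrespondence A (X n)]
    {P : ProductSystem A X} {H : Type*} [NormedAddCommGroup H] [InnerProductSpace ℂ H]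
    [CompleteSpace H]
    {R : CCRep P H} {p m q : Fin k → ℕ}

theorem IsNondegenerate.funext (hR : R.IsNondegenerate) {G : Type*} [AddCommGroup G]
    [Module ℂ G] [TopologicalSpace G] [T2Space G] {S T : H →ₗ[ℂ] G} (hS : Continuous S)
    (hT : Continuous T) (h : ∀ a g, S (R.σ a g) = T (R.σ a g)) (g : H) : S g = T g := by
  have hd : Dense (Submodule.span ℂ {h : H | ∃ (a : A) (h' : H), h = R.σ a h'} : Set H) := by
    rw [dense_iff_closure_eq, ← Submodule.topologicalClosure_coe, hR, Submodule.top_coe]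
  refine congrFun (hS.ext_on hd hT fun x hx => ?_) g
  refine LinearMap.eqOn_span (f := S) (g := T) ?_ hx
  rintro _ ⟨a, h', rfl⟩
  exact h a h'

/-- On the dense span of the `σ(a)g` the adjoint is explicit, `σ(a)g ↦ a ⊗ g`. Nondegeneracy thus
makes `T̃_0` a coisometry. -/
theorem IsNondegenerate.tilde_zero_adjoint (hR : R.IsNondegenerate) (h : H) :
    R.tilde 0 (ContinuousLinearMap.adjoint (R.tilde 0) h) = h := by
  refine hR.funext (S := (R.tilde 0 ∘L ContinuousLinearMap.adjoint (R.tilde 0)).toLinearMap)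
    (T := LinearMap.id) (ContinuousLinearMap.continuous _) continuous_id (fun a g => ?_) h
  simp [adjoint_tilde_zero_σ, tilde_tmul, R.T_zero]

theorem IsNondegenerate.creation_adjoint_tilde_zero (hR : R.IsNondegenerate) (h : p + 0 = q)
    (x : X p) (g : H) : P.creation R.σ h x (ContinuousLinearMap.adjoint (R.tilde 0) g) =
      intTmul R.σ (h ▸ x : X q) g := by
  obtain rfl : p = q := by simpa using h
  refine hR.funext
    (S := (P.creation R.σ h x ∘L ContinuousLinearMap.adjoint (R.tilde 0)).toLinearMap)
    (T := intTmul R.σ x) (ContinuousLinearMap.continuous _) (continuous_intTmul_right _ _)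
    (fun a g => ?_) g
  simp only [ContinuousLinearMap.coe_coe, ContinuousLinearMap.comp_apply, adjoint_tilde_zero_σ,
    P.creation_tmul, P.mul_unit, LinearEquiv.apply_symm_apply]
  refine intTensor_ext_inner fun y g' => ?_
  rw [inner_intTmul, inner_intTmul, ip_ract_right, map_mul, mul_apply_eq_comp]

theorem IsNondegenerate.idTensorAdj_add_zero (hR : R.IsNondegenerate) :
    R.idTensorAdj (add_zero m) = 1 :=
  intTensor_clm_ext _ fun x g => by
    rw [idTensorAdj_tmul, hR.creation_adjoint_tilde_zero]; rfl

/-- The vectors `x ⊗ z` are total in `X(q) ⊗ H`: for `m ≠ 0` because products are dense in `X(q)`,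
for `m = 0` because `x ⊗ T̃_0^* g` is `x ⊗ g`. For `p = 0` this could fail, as the left action may
be degenerate. -/
theorem IsNondegenerate.creation_ext (hR : R.IsNondegenerate) (h : p + m = q) (hp : p ≠ 0)
    {G : Type*} [NormedAddCommGroup G] [NormedSpace ℂ G] {S T : IntTensor (X q) R.σ →L[ℂ] G}
    (hST : ∀ x z, S (P.creation R.σ h x z) = T (P.creation R.σ h x z)) : S = T := by
  refine intTensor_clm_ext _ fun x g => ?_
  by_cases hm : m = 0
  · subst hm
    obtain rfl : p = q := by simpa using h
    have := hST x (ContinuousLinearMap.adjoint (R.tilde 0) g)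
    rwa [hR.creation_adjoint_tilde_zero] at this
  · have hd : Dense (Submodule.span ℂ {z : X q | ∃ (x : X p) (y : X m), z = P.mul h x y} :
        Set (X q)) := by
      rw [dense_iff_closure_eq, ← Submodule.topologicalClosure_coe, P.dense_mul h hp hm,
        Submodule.top_coe]
    refine congrFun ((S.continuous.comp (continuous_intTmul_left R.σ g)).ext_on hd
      (T.continuous.comp (continuous_intTmul_left R.σ g)) fun x hx => ?_) x
    refine LinearMap.eqOn_span (f := S.toLinearMap ∘ₗ (intTmul R.σ).flip g)
      (g := T.toLinearMap ∘ₗ (intTmul R.σ).flip g) ?_ hx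
    rintro _ ⟨x, y, rfl⟩
    have := hST x (intTmul R.σ y g)
    rwa [P.creation_tmul] at this

theorem IsNondegenerate.idTensorTilde_creation_comm (hR : R.IsNondegenerate) {p' q' r : Fin k → ℕ}
    (h : p + m = q) (h' : r + p = p')
    (h'' : r + q = q') (h₄ : p' + m = q') (x : X r) (z : IntTensor (X q) R.σ) :
    R.idTensorTilde h₄ (P.creation R.σ h'' x z) = P.creation R.σ h' x (R.idTensorTilde h z) := by
  by_cases hp : p = 0
  · subst hp
    obtain rfl : r = p' := by simpa using h'
    obtain rfl : m = q := by simpa using h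
    rw [idTensorTilde_zero_add, hR.creation_adjoint_tilde_zero, idTensorTilde_creation]
  · have : R.idTensorTilde h₄ ∘L P.creation R.σ h'' x =
        P.creation R.σ h' x ∘L R.idTensorTilde h := hR.creation_ext h hp fun y w => by
      rw [ContinuousLinearMap.comp_apply, ContinuousLinearMap.comp_apply, idTensorTilde_creation,
        P.creation_tmul, ← P.creation_mul R.σ h' h₄ h h'', idTensorTilde_creation]
    exact DFunLike.congr_fun this z

/-- This is the adjoint of `T̃_p (I_p ⊗ T̃_m) = T̃_{p+m}`, which is the multiplicativity of `T`. -/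
theorem IsNondegenerate.idTensorAdj_adjoint_tilde (hR : R.IsNondegenerate) (h : p + m = q)
    (g : H) : R.idTensorAdj h (ContinuousLinearMap.adjoint (R.tilde p) g) =
      ContinuousLinearMap.adjoint (R.tilde q) g := by
  by_cases hp : p = 0
  · subst hp
    obtain rfl : m = q := by simpa using h
    rw [idTensorAdj_zero_add, hR.tilde_zero_adjoint]
  · have : R.tilde p ∘L R.idTensorTilde h = R.tilde q := hR.creation_ext h hp fun x z => by
      rw [ContinuousLinearMap.comp_apply, idTensorTilde_creation, tilde_tmul, tilde_creation]
    rw [← this, ContinuousLinearMap.adjoint_comp, adjoint_idTensorTilde,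
      ContinuousLinearMap.comp_apply]

theorem IsNondegenerate.idTensorAdj_idTensorAdj (hR : R.IsNondegenerate) {n r mn : Fin k → ℕ}
    (h₁ : p + m = q) (h₂ : q + n = r) (h₃ : m + n = mn) (h₄ : p + mn = r)
    (z : IntTensor (X p) R.σ) :
    R.idTensorAdj h₂ (R.idTensorAdj h₁ z) = R.idTensorAdj h₄ z := by
  have : R.idTensorAdj h₂ ∘L R.idTensorAdj h₁ = R.idTensorAdj h₄ :=
    intTensor_clm_ext _ fun x g => by
      rw [ContinuousLinearMap.comp_apply, idTensorAdj_tmul, idTensorAdj_tmul,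
        R.idTensorAdj_creation h₃ h₁ h₄ h₂, hR.idTensorAdj_adjoint_tilde]
  rw [← this, ContinuousLinearMap.comp_apply]

theorem IsNondegenerate.idTensorTilde_idTensorTilde (hR : R.IsNondegenerate) {n r mn : Fin k → ℕ}
    (h₁ : p + m = q) (h₂ : q + n = r) (h₃ : m + n = mn) (h₄ : p + mn = r)
    (z : IntTensor (X r) R.σ) :
    R.idTensorTilde h₁ (R.idTensorTilde h₂ z) = R.idTensorTilde h₄ z := by
  refine ext_inner_right ℂ fun w => ?_
  rw [inner_idTensorTilde_left, inner_idTensorTilde_left, inner_idTensorTilde_left,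
    hR.idTensorAdj_idTensorAdj h₁ h₂ h₃ h₄]

theorem IsNondegenerate.idTensorTilde_zero_add_eq (hR : R.IsNondegenerate)
    (z : IntTensor (X m) R.σ) : R.tilde 0 (R.idTensorTilde (zero_add m) z) = R.tilde m z := by
  rw [idTensorTilde_zero_add, hR.tilde_zero_adjoint]

/-- `(I ⊗ T̃_j^*) (I ⊗ T̃_i) = (I ⊗ T̃_i) (I ⊗ T̃_j^*)` on `X (p + e_i) ⊗_σ H`. -/
theorem IsDoublyCommuting.idTensorAdj_idTensorTilde_eIdx (hdc : R.IsDoublyCommuting)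
    (hR : R.IsNondegenerate) {i j : Fin k} (hij : i ≠ j) {qi qj r : Fin k → ℕ}
    (h₁ : p + eIdx i = qi) (h₂ : p + eIdx j = qj) (h₃ : qi + eIdx j = r) (h₄ : qj + eIdx i = r)
    (z : IntTensor (X qi) R.σ) :
    R.idTensorAdj h₂ (R.idTensorTilde h₁ z) = R.idTensorTilde h₄ (R.idTensorAdj h₃ z) := by
  -- For `p = 0` the identity is the definition of double commutation, read through `X(0) ⊗ H ≅ H`.
  -- For `p ≠ 0` both sides commute with creation by elements of `X(p)`, which reduces to `p = 0`.
  have base : ∀ (h₄ : eIdx j + eIdx i = eIdx i + eIdx j) (w : IntTensor (X (eIdx i)) R.σ),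
      R.idTensorAdj (zero_add (eIdx j)) (R.idTensorTilde (zero_add (eIdx i)) w) =
        R.idTensorTilde h₄ (R.idTensorAdj rfl w) := by
    intro h₄ w
    rw [idTensorAdj_zero_add, hR.idTensorTilde_zero_add_eq]
    exact DFunLike.congr_fun (hdc i j hij) w
  by_cases hp : p = 0
  · subst hp
    obtain rfl : eIdx i = qi := by simpa using h₁
    obtain rfl : eIdx j = qj := by simpa using h₂
    subst h₃
    exact base h₄ z
  · have : R.idTensorAdj h₂ ∘L R.idTensorTilde h₁ = R.idTensorTilde h₄ ∘L R.idTensorAdj h₃ := by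
      refine hR.creation_ext h₁ hp fun x w => ?_
      have h₅ : p + (eIdx i + eIdx j) = r := by rw [← add_assoc, h₁, h₃]
      rw [ContinuousLinearMap.comp_apply, ContinuousLinearMap.comp_apply,
        R.idTensorAdj_creation rfl h₁ h₅ h₃,
        hR.idTensorTilde_creation_comm (add_comm (eIdx j) (eIdx i)) h₂ h₅ h₄,
        hR.idTensorTilde_creation_comm (zero_add (eIdx i)) (add_zero p) h₁ h₁,
        R.idTensorAdj_creation (zero_add (eIdx j)) (add_zero p) h₂ h₂, base]
    exact DFunLike.congr_fun this z

/-- The generators of `n` are passed one at a time; none of them is `e_i` because `n_i = 0`. -/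
theorem IsDoublyCommuting.idTensorAdj_idTensorTilde (hdc : R.IsDoublyCommuting)
    (hR : R.IsNondegenerate) {i : Fin k} {n : Fin k → ℕ} (hn : n i = 0) {qi qn r : Fin k → ℕ}
    (h₁ : p + eIdx i = qi) (h₂ : p + n = qn) (h₃ : qi + n = r) (h₄ : qn + eIdx i = r)
    (z : IntTensor (X qi) R.σ) :
    R.idTensorAdj h₂ (R.idTensorTilde h₁ z) = R.idTensorTilde h₄ (R.idTensorAdj h₃ z) := by
  induction n using multiIndex_induction generalizing p qi qn r with
  | zero =>
    obtain rfl : p = qn := by simpa using h₂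
    obtain rfl : qi = r := by simpa using h₃
    rw [hR.idTensorAdj_add_zero, hR.idTensorAdj_add_zero, one_apply_eq_self, one_apply_eq_self]
  | step n j ih =>
    have hij : i ≠ j := by
      rintro rfl
      simp [eIdx_apply] at hn
    have hn' : n i = 0 := by
      simp only [Pi.add_apply, Nat.add_eq_zero_iff] at hn
      exact hn.2
    rw [← hR.idTensorAdj_idTensorAdj (q := p + eIdx j) rfl (by rw [add_assoc, h₂]) rfl h₂,
      ← hR.idTensorAdj_idTensorAdj (q := qi + eIdx j) rfl (by rw [add_assoc, h₃]) rfl h₃,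
      hdc.idTensorAdj_idTensorTilde_eIdx hR hij h₁ rfl rfl
        (by rw [← h₁, add_right_comm]), ih hn']

theorem IsDoublyCommuting.idTensorTilde_idTensorAdj (hdc : R.IsDoublyCommuting)
    (hR : R.IsNondegenerate) {i : Fin k} {n : Fin k → ℕ} (hn : n i = 0) {qi qn r : Fin k → ℕ}
    (h₁ : p + eIdx i = qi) (h₂ : p + n = qn) (h₃ : qi + n = r) (h₄ : qn + eIdx i = r)
    (z : IntTensor (X qn) R.σ) :
    R.idTensorTilde h₃ (R.idTensorAdj h₄ z) = R.idTensorAdj h₁ (R.idTensorTilde h₂ z) := by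
  refine ext_inner_right ℂ fun w => ?_
  rw [inner_idTensorTilde_left, ← inner_idTensorTilde_right, ← inner_idTensorTilde_right,
    inner_idTensorTilde_left, hdc.idTensorAdj_idTensorTilde hR hn h₁ h₂ h₃ h₄]

end CCRep

/-! ### The defect operators -/

theorem eSet_apply {k : ℕ} (u : Finset (Fin k)) (j : Fin k) :
    eSet u j = if j ∈ u then 1 else 0 := by
  simp [eSet, Finset.sum_apply, Pi.single_apply]

theorem eSet_insert {k : ℕ} {u : Finset (Fin k)} {i : Fin k} (hi : i ∉ u) :
    eSet (insert i u) = eIdx i + eSet u :=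
  Finset.sum_insert hi

theorem eSet_le {k : ℕ} {u : Finset (Fin k)} {r : Fin k → ℕ} (h : ∀ i ∈ u, r i ≠ 0) :
    eSet u ≤ r := fun i => by
  rw [eSet_apply]
  split_ifs with hi
  · exact Nat.one_le_iff_ne_zero.mpr (h i hi)
  · exact Nat.zero_le _

namespace CCRep

variable {A : Type*} [NonUnitalCStarAlgebra A] [PartialOrder A]
    [StarOrderedRing A] {k : ℕ} {X : (Fin k → ℕ) → Type*} [∀ n, NormedAddCommGroup (X n)]
    [∀ n, NormedSpace ℂ (X n)] [∀ n, CompleteSpace (X n)] [∀ n, CStarCorrespondence A (X n)]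
    {P : ProductSystem A X} {H : Type*} [NormedAddCommGroup H] [InnerProductSpace ℂ H]
    [CompleteSpace H]
    {R : CCRep P H} {p m n q : Fin k → ℕ}

theorem idTensorSq_eq (h : p + m = n) :
    R.idTensorSq n m = R.idTensorAdj h ∘L R.idTensorTilde h := by
  have hmn : m ≤ n := h ▸ le_add_self
  obtain rfl : p = n - m := by rw [← h, add_tsub_cancel_right]
  rw [idTensorSq, dif_pos hmn]

theorem isSelfAdjoint_idTensorSq (hmn : m ≤ n) : star (R.idTensorSq n m) = R.idTensorSq n m := by
  rw [idTensorSq_eq (tsub_add_cancel_of_le hmn), ContinuousLinearMap.star_eq_adjoint,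
    ContinuousLinearMap.adjoint_comp, adjoint_idTensorTilde]
  rfl

theorem norm_idTensorTilde_le (h : p + m = q) : ‖R.idTensorTilde h‖ ≤ 1 :=
  (ContinuousLinearMap.adjoint.norm_map _).trans_le (R.norm_idTensorAdj_le h)

/-- The quadratic form is `‖z‖² - ‖(I ⊗ T̃_m) z‖²`, and `I ⊗ T̃_m` is a contraction. -/
theorem one_sub_idTensorSq_nonneg (hmn : m ≤ n) : 0 ≤ 1 - R.idTensorSq n m := by
  have h := tsub_add_cancel_of_le hmn
  rw [ContinuousLinearMap.nonneg_iff_isPositive, ContinuousLinearMap.isPositive_iff_complex]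
  intro z
  have e : ⟪(1 - R.idTensorSq n m) z, z⟫_ℂ = ((‖z‖ ^ 2 - ‖R.idTensorTilde h z‖ ^ 2 : ℝ) : ℂ) := by
    rw [idTensorSq_eq h, Complex.ofReal_sub, ofReal_norm_sq_eq_inner, ofReal_norm_sq_eq_inner,
      sub_apply, inner_sub_left, one_apply_eq_self, ContinuousLinearMap.comp_apply,
      inner_idTensorTilde_right]
  rw [e, RCLike.re_to_complex, Complex.ofReal_re]
  refine ⟨rfl, sub_nonneg.mpr ?_⟩
  have h1 : ‖R.idTensorTilde h z‖ ≤ ‖z‖ := by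
    simpa using (R.idTensorTilde h).le_of_opNorm_le (norm_idTensorTilde_le h) z
  exact pow_le_pow_left₀ (norm_nonneg _) h1 2

theorem IsNondegenerate.idTensorSq_zero (hR : R.IsNondegenerate) : R.idTensorSq n 0 = 1 := by
  rw [idTensorSq_eq (add_zero n), idTensorTilde, hR.idTensorAdj_add_zero,
    ← ContinuousLinearMap.star_eq_adjoint, star_one]
  rfl

/-- In `(T̃_i^* T̃_i)(T̃_m^* T̃_m)`, with identities tensored on, the middle factors `T̃_i` and
`T̃_m^*` may be interchanged; then the outer pairs combine to `T̃_{e_i+m}^*` and `T̃_{e_i+m}`. -/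
theorem IsDoublyCommuting.idTensorSq_mul (hdc : R.IsDoublyCommuting) (hR : R.IsNondegenerate)
    {i : Fin k} (hm : m i = 0) (h : eIdx i + m ≤ n) :
    R.idTensorSq n (eIdx i) * R.idTensorSq n m = R.idTensorSq n (eIdx i + m) := by
  obtain ⟨p, rfl⟩ := exists_add_of_le h
  have h₁ : p + m + eIdx i = eIdx i + m + p := by abel
  have h₂ : p + eIdx i + m = eIdx i + m + p := by abel
  have h₃ : p + (eIdx i + m) = eIdx i + m + p := by abel
  rw [idTensorSq_eq h₁, idTensorSq_eq h₂, idTensorSq_eq h₃]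
  refine ContinuousLinearMap.ext fun z => ?_
  simp only [mul_apply_eq_comp, ContinuousLinearMap.comp_apply]
  rw [← hdc.idTensorAdj_idTensorTilde hR hm rfl rfl h₂ h₁,
    hR.idTensorAdj_idTensorAdj rfl h₁ (add_comm _ _) h₃,
    hR.idTensorTilde_idTensorTilde rfl h₂ rfl h₃]

/-- A product of two self-adjoint operators that is itself self-adjoint is a commuting product. -/
theorem IsDoublyCommuting.commute_idTensorSq (hdc : R.IsDoublyCommuting)
    (hR : R.IsNondegenerate) {i : Fin k} (hm : m i = 0) (h : eIdx i + m ≤ n) :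
    Commute (R.idTensorSq n (eIdx i)) (R.idTensorSq n m) := by
  have h1 := hdc.idTensorSq_mul hR hm h
  have h2 := congrArg star h1
  rw [star_mul, isSelfAdjoint_idTensorSq h, isSelfAdjoint_idTensorSq (le_self_add.trans h),
    isSelfAdjoint_idTensorSq (le_add_self.trans h)] at h2
  exact h1.trans h2.symm

variable (R) in
/-- The operator `∑_{u ⊆ v} (-1)^|u| (I_{n - e(u)} ⊗ T̃_{e(u)}^* T̃_{e(u)})` on `X n ⊗_σ H`. -/
noncomputable def defectAt (n : Fin k → ℕ) (v : Finset (Fin k)) :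
    IntTensor (X n) R.σ →L[ℂ] IntTensor (X n) R.σ :=
  ∑ u ∈ v.powerset, (-1 : ℂ) ^ u.card • R.idTensorSq n (eSet u)

theorem IsNondegenerate.defectAt_empty (hR : R.IsNondegenerate) : R.defectAt n ∅ = 1 := by
  have : eSet (∅ : Finset (Fin k)) = 0 := Finset.sum_empty
  simp [defectAt, this, hR.idTensorSq_zero]

theorem eIdx_add_eSet_le {v u : Finset (Fin k)} {i : Fin k} (hi : i ∉ v) (hu : u ⊆ v)
    (hv : ∀ j ∈ insert i v, n j ≠ 0) : eIdx i + eSet u ≤ n := by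
  rw [← eSet_insert fun h => hi (hu h)]
  exact eSet_le fun j hj => hv j (Finset.insert_subset_insert i hu hj)

/-- Split the subsets of `v ∪ {i}` by whether they contain `i`: each term with `i` is minus `I ⊗
T̃_i^* T̃_i` times the corresponding term without `i`. -/
theorem IsDoublyCommuting.defectAt_insert (hdc : R.IsDoublyCommuting) (hR : R.IsNondegenerate)
    {v : Finset (Fin k)} {i : Fin k} (hi : i ∉ v) (hv : ∀ j ∈ insert i v, n j ≠ 0) :
    R.defectAt n (insert i v) = (1 - R.idTensorSq n (eIdx i)) * R.defectAt n v := by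
  rw [defectAt, Finset.sum_powerset_insert hi, sub_mul, one_mul, sub_eq_add_neg, defectAt,
    Finset.mul_sum, ← Finset.sum_neg_distrib]
  congr 1
  refine Finset.sum_congr rfl fun u hu => ?_
  have hu' := Finset.mem_powerset.mp hu
  have hiu : i ∉ u := fun h => hi (hu' h)
  rw [Finset.card_insert_of_notMem hiu, eSet_insert hiu, mul_smul_comm,
    hdc.idTensorSq_mul hR (by rw [eSet_apply, if_neg hiu]) (eIdx_add_eSet_le hi hu' hv), pow_succ,
    mul_neg_one, neg_smul]

theorem IsDoublyCommuting.commute_one_sub_defectAt (hdc : R.IsDoublyCommuting)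
    (hR : R.IsNondegenerate) {v : Finset (Fin k)} {i : Fin k} (hi : i ∉ v)
    (hv : ∀ j ∈ insert i v, n j ≠ 0) :
    Commute (1 - R.idTensorSq n (eIdx i)) (R.defectAt n v) := by
  refine Commute.sum_right _ _ _ fun u hu => Commute.smul_right ?_ _
  have hu' := Finset.mem_powerset.mp hu
  have hiu : i ∉ u := fun h => hi (hu' h)
  exact (Commute.one_left _).sub_left (hdc.commute_idTensorSq hR
    (by rw [eSet_apply, if_neg hiu]) (eIdx_add_eSet_le hi hu' hv))

theorem IsDoublyCommuting.defectAt_nonneg (hdc : R.IsDoublyCommuting) (hR : R.IsNondegenerate)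
    {v : Finset (Fin k)} (hv : ∀ j ∈ v, n j ≠ 0) : 0 ≤ R.defectAt n v := by
  induction v using Finset.induction_on with
  | empty => rw [hR.defectAt_empty]; exact zero_le_one
  | insert i v hi ih =>
    rw [hdc.defectAt_insert hR hi hv]
    refine Commute.mul_nonneg (one_sub_idTensorSq_nonneg ?_)
      (ih fun j hj => hv j (Finset.mem_insert_of_mem hj))
      (hdc.commute_one_sub_defectAt hR hi hv)
    exact le_self_add.trans (eIdx_add_eSet_le hi subset_rfl hv)

theorem eIdx_le_eSet {v : Finset (Fin k)} {i : Fin k} (hi : i ∈ v) : eIdx i ≤ eSet v :=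
  fun j => by
    rw [eIdx_apply, eSet_apply]
    split_ifs with h1 h2 <;> simp_all

theorem IsDoublyCommuting.pairwise_commute_defectFactor (hdc : R.IsDoublyCommuting)
    (hR : R.IsNondegenerate) (v : Finset (Fin k)) :
    (v : Set (Fin k)).Pairwise (Function.onFun Commute (R.defectFactor v)) := by
  intro i hi j hj hij
  refine (Commute.one_left _).sub_left ((Commute.one_right _).sub_right ?_)
  refine hdc.commute_idTensorSq hR (by rw [eIdx_apply, if_neg hij]) fun l => ?_
  rw [Finset.mem_coe] at hi hj
  rw [Pi.add_apply, eIdx_apply, eIdx_apply, eSet_apply]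
  split_ifs with h1 h2 h3 h4 <;> simp_all

theorem IsDoublyCommuting.defect_eq_noncommProd (hdc : R.IsDoublyCommuting)
    (hR : R.IsNondegenerate) (v : Finset (Fin k))
    (hc : (v : Set (Fin k)).Pairwise (Function.onFun Commute (R.defectFactor v))) :
    R.defect v = v.noncommProd (R.defectFactor v) hc := by
  -- The induction runs over subsets `w` inside the fixed space `X(e(v)) ⊗ H`, so that the factors
  -- do not change with `w`.
  have key : ∀ w : Finset (Fin k), ∀ hw : w ⊆ v, R.defectAt (eSet v) w =
      w.noncommProd (R.defectFactor v) (hc.mono (Finset.coe_subset.mpr hw)) := by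
    intro w
    induction w using Finset.induction_on with
    | empty => intro _; rw [hR.defectAt_empty, Finset.noncommProd_empty]
    | insert i w hi ih =>
      intro hw
      rw [Finset.noncommProd_insert_of_notMem _ _ _ _ hi,
        hdc.defectAt_insert hR hi fun j hj => by simp [eSet_apply, hw hj],
        ih ((Finset.subset_insert i w).trans hw)]
      rfl
  exact key v subset_rfl

end CCRep

/-! ### The space of the dilation -/

/-- Möbius inversion on a box. After substituting `s = r - e(u)`, the coefficient of `f s` is the
alternating sum over all subsets of `{i | s_i < N_i}`, which vanishes unless this set is empty, that
is, unless `s = N`. -/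
theorem sum_Iic_sum_powerset {k : ℕ} (f : (Fin k → ℕ) → ℂ) (N : Fin k → ℕ) :
    ∑ r ∈ Finset.Iic N, ∑ u ∈ (Finset.univ.filter fun i => r i ≠ 0).powerset,
      (-1 : ℂ) ^ u.card * f (r - eSet u) = f N := by
  have h1 : ∑ r ∈ Finset.Iic N, ∑ u ∈ (Finset.univ.filter fun i => r i ≠ 0).powerset,
      (-1 : ℂ) ^ u.card * f (r - eSet u) =
      ∑ s ∈ Finset.Iic N, ∑ u ∈ (Finset.univ.filter fun i => s i < N i).powerset,
        (-1 : ℂ) ^ u.card * f s := by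
    rw [Finset.sum_sigma', Finset.sum_sigma']
    have hle : ∀ (r : Fin k → ℕ) (u : Finset (Fin k)),
        u ⊆ (Finset.univ.filter fun i => r i ≠ 0) → eSet u ≤ r := fun r u hu =>
      eSet_le fun i hi => (Finset.mem_filter.mp (hu hi)).2
    refine Finset.sum_bij' (fun x _ => ⟨x.1 - eSet x.2, x.2⟩) (fun x _ => ⟨x.1 + eSet x.2, x.2⟩)
      ?_ ?_ ?_ ?_ ?_
    · rintro ⟨r, u⟩ h
      simp only [Finset.mem_sigma, Finset.mem_Iic, Finset.mem_powerset] at h ⊢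
      refine ⟨tsub_le_self.trans h.1, fun i hi => ?_⟩
      have h2 : r i ≠ 0 := (Finset.mem_filter.mp (h.2 hi)).2
      have h3 : r i ≤ N i := h.1 i
      simp only [Finset.mem_filter, Finset.mem_univ, true_and, Pi.sub_apply, eSet_apply, hi,
        if_true]
      omega
    · rintro ⟨s, u⟩ h
      simp only [Finset.mem_sigma, Finset.mem_Iic, Finset.mem_powerset] at h ⊢
      refine ⟨fun i => ?_, fun i hi => ?_⟩
      · have h3 := h.1 i
        simp only [Pi.add_apply, eSet_apply]
        split_ifs with hi
        · have := (Finset.mem_filter.mp (h.2 hi)).2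
          omega
        · omega
      · simp [eSet_apply, hi]
    · rintro ⟨r, u⟩ h
      simp only [Finset.mem_sigma, Finset.mem_Iic, Finset.mem_powerset] at h
      simp only [tsub_add_cancel_of_le (hle r u h.2)]
    · rintro ⟨s, u⟩ _
      simp only [add_tsub_cancel_right]
    · rintro ⟨r, u⟩ _
      rfl
  rw [h1]
  simp only [← Finset.sum_mul]
  rw [Finset.sum_eq_single N]
  · simp
  · intro s hs hsN
    have hne : (Finset.univ.filter fun i => s i < N i) ≠ ∅ := by
      intro h
      refine hsN (le_antisymm (Finset.mem_Iic.mp hs) fun i => ?_)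
      by_contra hi
      have : i ∈ (Finset.univ.filter fun i => s i < N i) := by simpa using hi
      simp [h] at this
    have h0 := Finset.sum_powerset_neg_one_pow_card (x := Finset.univ.filter fun i => s i < N i)
    rw [if_neg hne] at h0
    have h2 := congrArg (fun t : ℤ => (t : ℂ)) h0
    push_cast at h2
    rw [h2, zero_mul]
  · intro h
    simp at h

/-- Cuts the ambient `ℓ²` sum down to the closed span of the given ranges, so that the dilation
built on it is minimal. -/
theorem exists_codRestrict_dense {F : Type*} [NormedAddCommGroup F] [InnerProductSpace ℂ F]
    [CompleteSpace F] {ι : Type*} {G : ι → Type*} [∀ n, AddCommGroup (G n)] [∀ n, Module ℂ (G n)]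
    (Φ : ∀ n, G n →ₗ[ℂ] F) : ∃ (M : Submodule ℂ F) (_ : CompleteSpace M)
      (j : ∀ n, G n →ₗ[ℂ] M), (∀ n z, (j n z : F) = Φ n z) ∧
        (Submodule.span ℂ {x : M | ∃ n z, x = j n z}).topologicalClosure = ⊤ := by
  let S : Submodule ℂ F := Submodule.span ℂ {x | ∃ n z, x = Φ n z}
  have hmem : ∀ n z, Φ n z ∈ S.topologicalClosure := fun n z =>
    S.le_topologicalClosure (Submodule.subset_span ⟨n, z, rfl⟩)
  refine ⟨S.topologicalClosure, inferInstance,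
    fun n => (Φ n).codRestrict _ (hmem n), fun _ _ => rfl, ?_⟩
  rw [Submodule.topologicalClosure_eq_top_iff, eq_bot_iff]
  rintro ⟨x, hx⟩ hxo
  rw [Submodule.mem_bot, Submodule.mk_eq_zero]
  have h1 : x ∈ Sᗮ := by
    rw [Submodule.mem_orthogonal]
    intro u hu
    induction hu using Submodule.span_induction with
    | mem u hu =>
      obtain ⟨n, z, rfl⟩ := hu
      exact (Submodule.mem_orthogonal _ _).mp hxo _ (Submodule.subset_span ⟨n, z, rfl⟩)
    | zero => exact inner_zero_left _
    | add a b _ _ ha hb => rw [inner_add_left, ha, hb, add_zero]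
    | smul c a _ ha => rw [inner_smul_left, ha, mul_zero]
  have h2 : x ∈ S.topologicalClosureᗮ := by rwa [Submodule.orthogonal_closure]
  exact inner_self_eq_zero.mp ((Submodule.mem_orthogonal _ _).mp h2 x hx)

theorem inner_sum_lpSingle {ι : Type*} [DecidableEq ι] {G : ι → Type*}
    [∀ i, NormedAddCommGroup (G i)] [∀ i, InnerProductSpace ℂ (G i)] (s t : Finset ι)
    (x y : ∀ i, G i) (hy : ∀ i ∉ t, y i = 0) :
    ⟪∑ i ∈ s, lp.single (E := G) 2 i (x i), ∑ i ∈ t, lp.single (E := G) 2 i (y i)⟫_ℂ =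
      ∑ i ∈ s, ⟪x i, y i⟫_ℂ := by
  rw [sum_inner]
  refine Finset.sum_congr rfl fun i _ => ?_
  rw [lp.inner_single_left, lp.coeFn_sum, Finset.sum_apply]
  simp only [lp.single_apply, Finset.sum_pi_single]
  split_ifs with h
  · rfl
  · rw [hy i h]

/-! ### Kernel families and their existence -/

namespace CCRep

variable {A : Type*} [NonUnitalCStarAlgebra A] [PartialOrder A]
    [StarOrderedRing A] {k : ℕ} {X : (Fin k → ℕ) → Type uX} [∀ n, NormedAddCommGroup (X n)]
    [∀ n, NormedSpace ℂ (X n)] [∀ n, CompleteSpace (X n)] [∀ n, CStarCorrespondence A (X n)]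
    {P : ProductSystem A X} {H : Type uH} [NormedAddCommGroup H] [InnerProductSpace ℂ H]
    [CompleteSpace H]
    (R : CCRep P H) {p m n q : Fin k → ℕ}

/-- A family of maps `j n : X n ⊗_σ H → K` with dense span, such that
`j m^* j n = I_s ⊗ T̃_b^* T̃_a` for `n = s + a`, `m = s + b`, where `s` is the minimum of `n`
and `m`. -/
structure IsKernelFamily {K : Type*} [NormedAddCommGroup K] [InnerProductSpace ℂ K]
    (j : ∀ n, IntTensor (X n) R.σ →ₗ[ℂ] K) : Prop where
  inner_eq : ∀ {s a b n m : Fin k → ℕ} (h : s + a = n) (h' : s + b = m),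
    (∀ i, a i = 0 ∨ b i = 0) → ∀ z w,
      ⟪j n z, j m w⟫_ℂ = ⟪R.idTensorTilde h z, R.idTensorTilde h' w⟫_ℂ
  dense : (Submodule.span ℂ {x : K | ∃ n z, x = j n z}).topologicalClosure = ⊤

open Classical in
/-- The operator `I_r ⊗ T̃_{n - r} : X n ⊗_σ H → X r ⊗_σ H` for `r ≤ n`, and `0` otherwise. -/
noncomputable def down (r n : Fin k → ℕ) : IntTensor (X n) R.σ →L[ℂ] IntTensor (X r) R.σ :=
  if h : r ≤ n then R.idTensorTilde (add_tsub_cancel_of_le h) else 0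

variable {R}

theorem down_eq {r : Fin k → ℕ} (h : r + m = n) : R.down r n = R.idTensorTilde h := by
  obtain rfl : m = n - r := by rw [← h, add_tsub_cancel_left]
  rw [down, dif_pos (h ▸ le_self_add)]

theorem down_of_not_le {r : Fin k → ℕ} (h : ¬ r ≤ n) : R.down r n = 0 :=
  dif_neg h

theorem IsNondegenerate.down_down (hR : R.IsNondegenerate) {s r : Fin k → ℕ} (h : s ≤ r)
    (h' : r ≤ n) (z : IntTensor (X n) R.σ) : R.down s r (R.down r n z) = R.down s n z := by
  obtain ⟨a, rfl⟩ := exists_add_of_le h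
  obtain ⟨b, rfl⟩ := exists_add_of_le h'
  rw [down_eq rfl, down_eq rfl, down_eq (add_assoc s a b).symm,
    hR.idTensorTilde_idTensorTilde rfl rfl rfl]

theorem inner_idTensorSq (hmn : m ≤ n) (z w : IntTensor (X n) R.σ) :
    ⟪z, R.idTensorSq n m w⟫_ℂ = ⟪R.down (n - m) n z, R.down (n - m) n w⟫_ℂ := by
  have h := tsub_add_cancel_of_le hmn
  rw [idTensorSq_eq h, down_eq h, ContinuousLinearMap.comp_apply, inner_idTensorTilde_left]

theorem IsDoublyCommuting.exists_isKernelFamily (hdc : R.IsDoublyCommuting)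
    (hR : R.IsNondegenerate) :
    ∃ (K : Type (max uX uH)) (_ : NormedAddCommGroup K) (_ : InnerProductSpace ℂ K)
      (_ : CompleteSpace K) (j : ∀ n, IntTensor (X n) R.σ →ₗ[ℂ] K), R.IsKernelFamily j := by
  classical
  have hex : ∀ r : Fin k → ℕ, ∃ N : IntTensor (X r) R.σ →L[ℂ] IntTensor (X r) R.σ,
      R.defectAt r (Finset.univ.filter fun i => r i ≠ 0) = star N * N := fun r =>
    exists_star_mul_self_of_nonneg (hdc.defectAt_nonneg hR fun j hj => (Finset.mem_filter.mp hj).2)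
  choose N hN using hex
  -- The factorization of the kernel: the component of `Φ_n` at `r ≤ n` is `N_r (I_r ⊗ T̃_{n-r})`,
  -- with `N_r^* N_r` the alternating sum over the support of `r`.
  let Φ : ∀ n, IntTensor (X n) R.σ →ₗ[ℂ] lp (fun r : Fin k → ℕ => IntTensor (X r) R.σ) 2 :=
    fun n => ∑ r ∈ Finset.Iic n, lp.lsingle (𝕜 := ℂ) 2 r ∘ₗ (N r ∘L R.down r n).toLinearMap
  have hΦ : ∀ n z, Φ n z = ∑ r ∈ Finset.Iic n, lp.single 2 r (N r (R.down r n z)) := by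
    intro n z
    simp only [Φ, LinearMap.sum_apply]
    rfl
  have hinner : ∀ n m z w, ⟪Φ n z, Φ m w⟫_ℂ = ⟪R.down (n ⊓ m) n z, R.down (n ⊓ m) m w⟫_ℂ := by
    intro n m z w
    rw [hΦ n z, hΦ m w, inner_sum_lpSingle _ _ (fun r => N r (R.down r n z))
      (fun r => N r (R.down r m w)) fun r hr => by
        rw [down_of_not_le (by simpa using hr), zero_apply, map_zero]]
    have h0 : ∑ r ∈ Finset.Iic n, ⟪N r (R.down r n z), N r (R.down r m w)⟫_ℂ
        = ∑ r ∈ Finset.Iic (n ⊓ m), ⟪N r (R.down r n z), N r (R.down r m w)⟫_ℂ := by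
      refine (Finset.sum_subset (Finset.Iic_subset_Iic.mpr inf_le_left) fun r hr hr' => ?_).symm
      have : ¬ r ≤ m := fun h => hr' (Finset.mem_Iic.mpr (le_inf (Finset.mem_Iic.mp hr) h))
      rw [down_of_not_le this, zero_apply, map_zero, inner_zero_right]
    -- Expanding `N_r^* N_r` turns the term at `r` into an alternating sum of the inner products of
    -- `I_s ⊗ T̃_{n-s}` and `I_s ⊗ T̃_{m-s}` at `s = r - e(u)`; inversion leaves only `s = min(n,
    -- m)`.
    rw [h0, ← sum_Iic_sum_powerset (fun s => ⟪R.down s n z, R.down s m w⟫_ℂ) (n ⊓ m)]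
    refine Finset.sum_congr rfl fun r hr => ?_
    have hr' := Finset.mem_Iic.mp hr
    rw [← ContinuousLinearMap.adjoint_inner_right, ← ContinuousLinearMap.star_eq_adjoint,
      ← mul_apply_eq_comp, ← hN, defectAt, sum_apply, inner_sum]
    refine Finset.sum_congr rfl fun u hu => ?_
    have hle : eSet u ≤ r :=
      eSet_le fun i hi => (Finset.mem_filter.mp (Finset.mem_powerset.mp hu hi)).2
    rw [smul_apply, inner_smul_right, inner_idTensorSq hle,
      hR.down_down tsub_le_self (hr'.trans inf_le_left),
      hR.down_down tsub_le_self (hr'.trans inf_le_right)]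
  obtain ⟨M, hM, j, hj, hd⟩ := exists_codRestrict_dense Φ
  refine ⟨M, inferInstance, inferInstance, hM, j, ⟨?_, hd⟩⟩
  intro s a b n m h h' hab z w
  rw [Submodule.coe_inner, hj, hj, hinner]
  obtain rfl : s = n ⊓ m := by
    funext i
    rw [← h, ← h', Pi.inf_apply, Pi.add_apply, Pi.add_apply]
    rcases hab i with h0 | h0 <;> simp [h0]
  rw [down_eq h, down_eq h']

end CCRep

/-! ### Construction of the dilation -/

/-- The bound is imposed on formal combinations, so it also ensures that the extension is well
defined when the vectors `v s` are linearly dependent. -/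
theorem exists_clm_of_span_dense {S K G : Type*} [NormedAddCommGroup K] [NormedSpace ℂ K]
    [NormedAddCommGroup G] [NormedSpace ℂ G] [CompleteSpace G] (v : S → K) (w : S → G)
    (hv : (Submodule.span ℂ (Set.range v)).topologicalClosure = ⊤) (C : ℝ)
    (hC : ∀ c : S →₀ ℂ, ‖Finsupp.linearCombination ℂ w c‖ ≤
      C * ‖Finsupp.linearCombination ℂ v c‖) : ∃ T : K →L[ℂ] G, ∀ s, T (v s) = w s := by
  refine ⟨(Finsupp.linearCombination ℂ w).extendOfNorm (Finsupp.linearCombination ℂ v),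
    fun s => ?_⟩
  have hd : DenseRange (Finsupp.linearCombination ℂ v) := by
    have : Set.range (Finsupp.linearCombination ℂ v) = (Submodule.span ℂ (Set.range v) : Set K) := by
      rw [← Finsupp.range_linearCombination]; rfl
    rw [DenseRange, this, dense_iff_closure_eq, ← Submodule.topologicalClosure_coe, hv,
      Submodule.top_coe]
  have := LinearMap.extendOfNorm_eq hd ⟨C, hC⟩ (Finsupp.single s 1)
  simpa using this

theorem exists_add_eq_add_eq {k : ℕ} (n m : Fin k → ℕ) :
    ∃ s a b : Fin k → ℕ, s + a = n ∧ s + b = m ∧ ∀ i, a i = 0 ∨ b i = 0 :=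
  ⟨n ⊓ m, n - n ⊓ m, m - n ⊓ m, add_tsub_cancel_of_le inf_le_left,
    add_tsub_cancel_of_le inf_le_right, fun i => by
      simp only [Pi.sub_apply, Pi.inf_apply]; omega⟩

namespace CCRep

variable {A : Type*} [NonUnitalCStarAlgebra A] [PartialOrder A]
    [StarOrderedRing A] {k : ℕ} {X : (Fin k → ℕ) → Type*} [∀ n, NormedAddCommGroup (X n)]
    [∀ n, NormedSpace ℂ (X n)] [∀ n, CompleteSpace (X n)] [∀ n, CStarCorrespondence A (X n)]
    {P : ProductSystem A X} {H : Type*} [NormedAddCommGroup H] [InnerProductSpace ℂ H]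
    [CompleteSpace H]
    {R : CCRep P H} {p m n q : Fin k → ℕ} {K : Type*} [NormedAddCommGroup K]
    [InnerProductSpace ℂ K] {j : ∀ n, IntTensor (X n) R.σ →ₗ[ℂ] K}

theorem IsKernelFamily.ext (hj : R.IsKernelFamily j) {G : Type*} [NormedAddCommGroup G]
    [NormedSpace ℂ G] {S T : K →L[ℂ] G} (h : ∀ n z, S (j n z) = T (j n z)) : S = T := by
  have hd : Dense (Submodule.span ℂ {x : K | ∃ n z, x = j n z} : Set K) := by
    rw [dense_iff_closure_eq, ← Submodule.topologicalClosure_coe, hj.dense, Submodule.top_coe]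
  refine ContinuousLinearMap.ext_on hd ?_
  rintro _ ⟨n, z, rfl⟩
  exact h n z

theorem IsKernelFamily.ext_inner (hj : R.IsKernelFamily j) {x y : K}
    (h : ∀ n z, ⟪j n z, x⟫_ℂ = ⟪j n z, y⟫_ℂ) : x = y := by
  have : innerSL ℂ x = innerSL ℂ y := hj.ext fun n z => by
    rw [innerSL_apply_apply, innerSL_apply_apply, ← inner_conj_symm, h, inner_conj_symm]
  refine ext_inner_right ℂ fun v => ?_
  rw [← innerSL_apply_apply, this, innerSL_apply_apply]

theorem IsKernelFamily.inner_same (hj : R.IsKernelFamily j) (hR : R.IsNondegenerate)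
    (z w : IntTensor (X n) R.σ) : ⟪j n z, j n w⟫_ℂ = ⟪z, w⟫_ℂ := by
  rw [hj.inner_eq (add_zero n) (add_zero n) (fun _ => Or.inl rfl), inner_idTensorTilde_left,
    hR.idTensorAdj_add_zero, idTensorTilde, hR.idTensorAdj_add_zero,
    ← ContinuousLinearMap.star_eq_adjoint, star_one]
  rfl

theorem IsKernelFamily.norm_map (hj : R.IsKernelFamily j) (hR : R.IsNondegenerate)
    (z : IntTensor (X n) R.σ) : ‖j n z‖ = ‖z‖ := by
  rw [norm_eq_sqrt_re_inner (𝕜 := ℂ), hj.inner_same hR, ← norm_eq_sqrt_re_inner]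

theorem IsKernelFamily.continuous (hj : R.IsKernelFamily j) (hR : R.IsNondegenerate)
    (n : Fin k → ℕ) : Continuous (j n) :=
  (LinearMap.mkContinuous (j n) 1 fun z => by rw [hj.norm_map hR, one_mul]).continuous

theorem IsKernelFamily.inner_disjoint (hj : R.IsKernelFamily j) (hR : R.IsNondegenerate)
    (h : ∀ i, n i = 0 ∨ m i = 0) (z : IntTensor (X n) R.σ) (w : IntTensor (X m) R.σ) :
    ⟪j n z, j m w⟫_ℂ = ⟪R.tilde n z, R.tilde m w⟫_ℂ := by
  rw [hj.inner_eq (zero_add n) (zero_add m) h, idTensorTilde_zero_add, idTensorTilde_zero_add,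
    ContinuousLinearMap.adjoint_inner_left, hR.tilde_zero_adjoint]

theorem IsKernelFamily.inner_leftAct (hj : R.IsKernelFamily j) (a : A)
    (z : IntTensor (X n) R.σ) (w : IntTensor (X m) R.σ) :
    ⟪j n (P.leftAct R.σ a z), j m w⟫_ℂ = ⟪j n z, j m (P.leftAct R.σ (star a) w)⟫_ℂ := by
  obtain ⟨s, a, b, h, h', hab⟩ := exists_add_eq_add_eq n m
  rw [hj.inner_eq h h' hab, hj.inner_eq h h' hab, idTensorTilde_leftAct, idTensorTilde_leftAct,
    P.inner_leftAct]

/-- The minimum of `p + n` and `p + m` is `p` plus that of `n` and `m`, and the remainders `a`, `b`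
are the same. Hence the kernel is invariant under a common shift, up to `φ(⟨x, y⟩)`. -/
theorem IsKernelFamily.inner_creation (hj : R.IsKernelFamily j) (hR : R.IsNondegenerate)
    {n' m' : Fin k → ℕ} (h : p + n = n') (h' : p + m = m') (x y : X p)
    (z : IntTensor (X n) R.σ) (w : IntTensor (X m) R.σ) :
    ⟪j n' (P.creation R.σ h x z), j m' (P.creation R.σ h' y w)⟫_ℂ =
      ⟪j n z, j m (P.leftAct R.σ (ip x y) w)⟫_ℂ := by
  obtain ⟨s, a, b, ha, hb, hab⟩ := exists_add_eq_add_eq n m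
  have ha' : p + s + a = n' := by rw [add_assoc, ha, h]
  have hb' : p + s + b = m' := by rw [add_assoc, hb, h']
  rw [hj.inner_eq ha' hb' hab, hj.inner_eq ha hb hab,
    hR.idTensorTilde_creation_comm ha rfl h ha', hR.idTensorTilde_creation_comm hb rfl h' hb',
    P.inner_creation, idTensorTilde_leftAct]

/-- Since `n_i = 0`, the remainder `a` of `n` has `a_i = 0`, so double commutation moves `T̃_i^*`
past `T̃_a`, and its adjoint is absorbed into `T̃_{e_i+b}` on the other side. In effect
`j_{n+e_i}((I ⊗ T̃_i^*) z)` is the projection of `j_n(z)` onto the closed span of the ranges of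
`j_{m'}` with `m'_i > 0`. -/
theorem IsKernelFamily.inner_idTensorAdj (hj : R.IsKernelFamily j) (hR : R.IsNondegenerate)
    (hdc : R.IsDoublyCommuting) {i : Fin k} (hn : n i = 0) {n' m' : Fin k → ℕ}
    (h : n + eIdx i = n') (h' : m + eIdx i = m') (w : IntTensor (X m') R.σ)
    (z : IntTensor (X n) R.σ) : ⟪j m' w, j n' (R.idTensorAdj h z)⟫_ℂ = ⟪j m' w, j n z⟫_ℂ := by
  obtain ⟨s, b, a, hb, ha, hab⟩ := exists_add_eq_add_eq m n
  have ha0 : a i = 0 := by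
    have := congrFun ha i
    simp only [Pi.add_apply] at this
    omega
  have ha' : s + eIdx i + a = n' := by rw [add_right_comm, ha, h]
  have hb' : s + eIdx i + b = m' := by rw [add_right_comm, hb, h']
  have hb'' : s + (eIdx i + b) = m' := by rw [← add_assoc, hb']
  have hab' : ∀ l, (eIdx i + b) l = 0 ∨ a l = 0 := fun l => by
    rw [Pi.add_apply, eIdx_apply]
    split_ifs with hl
    · subst hl
      exact Or.inr ha0
    · rw [zero_add]
      exact hab l
  rw [hj.inner_eq hb' ha' hab, hj.inner_eq hb'' ha hab',
    hdc.idTensorTilde_idTensorAdj hR ha0 rfl ha ha' h, ← inner_idTensorTilde_left,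
    hR.idTensorTilde_idTensorTilde rfl hb' rfl hb'']

theorem IsKernelFamily.norm_sum_creation_le (hj : R.IsKernelFamily j) (hR : R.IsNondegenerate)
    {ι : Type*} (t : Finset ι) (n : ι → Fin k → ℕ) (z : ∀ i, IntTensor (X (n i)) R.σ)
    (x : X p) : ‖∑ i ∈ t, j (p + n i) (P.creation R.σ rfl x (z i))‖ ≤
      ‖x‖ * ‖∑ i ∈ t, j (n i) (z i)‖ := by
  let Z : A → K := fun a => ∑ i ∈ t, j (n i) (P.leftAct R.σ a (z i))
  set ζ : K := ∑ i ∈ t, j (n i) (z i) with hζ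
  set b : A := ip x x with hb
  -- `Z a` stands for the image of `ζ` under `a`, whose boundedness is not yet known. With `b =
  -- 2√‖b‖ d - d²` and `d` self-adjoint, `‖b‖ ‖ζ‖² - ⟪ζ, Z b⟫` is the square `‖√‖b‖ ζ - Z d‖²`; this
  -- needs neither a unit in `A` nor a bound on `Z`.
  obtain ⟨d, hds, hd⟩ := exists_sub_sq (b := b) (ip_self_nonneg x)
  have e1 : ⟪∑ i ∈ t, j (p + n i) (P.creation R.σ rfl x (z i)),
      ∑ i ∈ t, j (p + n i) (P.creation R.σ rfl x (z i))⟫_ℂ = ⟪ζ, Z b⟫_ℂ := by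
    simp only [ζ, Z, sum_inner, inner_sum, hj.inner_creation hR, hb]
  have e2 : Z b = (2 * Real.sqrt ‖b‖ : ℂ) • Z d - Z (d * d) := by
    simp only [Z, Finset.smul_sum, ← Finset.sum_sub_distrib]
    refine Finset.sum_congr rfl fun i _ => ?_
    rw [← map_smul, ← map_sub]
    congr 1
    conv_lhs => rw [hd]
    simp only [ProductSystem.leftAct, map_sub, map_smul, sub_apply, smul_apply]
  have e3 : ⟪ζ, Z (d * d)⟫_ℂ = ⟪Z d, Z d⟫_ℂ := by
    simp only [ζ, Z, sum_inner, inner_sum, hj.inner_leftAct, hds, P.leftAct_mul]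
  have e4 := norm_sub_sq (𝕜 := ℂ) ((Real.sqrt ‖b‖ : ℂ) • ζ) (Z d)
  have hs := Real.mul_self_sqrt (norm_nonneg b)
  rw [inner_smul_left, Complex.conj_ofReal, norm_smul, Complex.norm_real,
    Real.norm_of_nonneg (Real.sqrt_nonneg _), mul_pow, sq (Real.sqrt _), hs,
    RCLike.re_to_complex, Complex.re_ofReal_mul] at e4
  have e5 : ‖∑ i ∈ t, j (p + n i) (P.creation R.σ rfl x (z i))‖ ^ 2
      = 2 * (Real.sqrt ‖b‖ * (⟪ζ, Z d⟫_ℂ).re) - ‖Z d‖ ^ 2 := by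
    rw [← inner_self_eq_norm_sq (𝕜 := ℂ), e1, e2, inner_sub_right, inner_smul_right, e3,
      ← inner_self_eq_norm_sq (𝕜 := ℂ) (Z d), map_sub, RCLike.re_to_complex]
    congr 1
    have : (2 * Real.sqrt ‖b‖ : ℂ) = ((2 * Real.sqrt ‖b‖ : ℝ) : ℂ) := by push_cast; rfl
    rw [this, Complex.re_ofReal_mul, mul_assoc]
  refine le_of_sq_le_sq ?_ (by positivity)
  rw [mul_pow, norm_sq_eq (A := A) x, e5]
  have := sq_nonneg ‖(Real.sqrt ‖b‖ : ℂ) • ζ - Z d‖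
  linarith

theorem IsKernelFamily.exists_shift [CompleteSpace K] (hj : R.IsKernelFamily j)
    (hR : R.IsNondegenerate) : ∃ V : ∀ p, X p →ₗ[ℂ] (K →L[ℂ] K),
      ∀ {p n q : Fin k → ℕ} (h : p + n = q) (x : X p) (z : IntTensor (X n) R.σ),
        V p x (j n z) = j q (P.creation R.σ h x z) := by
  have hex : ∀ (p : Fin k → ℕ) (x : X p), ∃ T : K →L[ℂ] K, ∀ n z,
      T (j n z) = j (p + n) (P.creation R.σ rfl x z) := by
    intro p x
    obtain ⟨T, hT⟩ := exists_clm_of_span_dense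
      (fun s : Σ n, IntTensor (X n) R.σ => j s.1 s.2)
      (fun s => j (p + s.1) (P.creation R.σ rfl x s.2))
      (by
        rw [← hj.dense]
        congr 2
        ext y
        simp [eq_comm]) ‖x‖ (fun c => by
        have := hj.norm_sum_creation_le hR c.support (fun s => s.1) (fun s => c s • s.2) x
        simpa only [Finsupp.linearCombination_apply, Finsupp.sum, map_smul] using this)
    exact ⟨T, fun n z => hT ⟨n, z⟩⟩
  choose V hV using hex
  refine ⟨fun p => ⟨⟨V p, fun x y => hj.ext fun n z => ?_⟩, fun c x => hj.ext fun n z => ?_⟩, ?_⟩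
  · simp only [hV, add_apply, map_add]
  · simp only [hV, smul_apply, map_smul, RingHom.id_apply]
  · intro p n q h x z
    subst h
    exact hV p x n z

/-- `V n (x)^* V n (y) = ρ(⟨x, y⟩)` for all `n`: all the maps `Ṽ_n` are isometries. -/
def IsIsometric (V : CCRep P H) : Prop :=
  ∀ (n : Fin k → ℕ) (x y : X n) (g h : H), ⟪V.T n x g, V.T n y h⟫_ℂ = ⟪g, V.σ (ip x y) h⟫_ℂ

theorem IsIsometric.inner_tilde {V : CCRep P H} (hV : V.IsIsometric) (n : Fin k → ℕ)
    (z w : IntTensor (X n) V.σ) : ⟪V.tilde n z, V.tilde n w⟫_ℂ = ⟪z, w⟫_ℂ := by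
  have : ContinuousLinearMap.adjoint (V.tilde n) ∘L V.tilde n = 1 :=
    intTensor_clm_ext _ fun x g => intTensor_ext_inner fun y h => by
      rw [ContinuousLinearMap.comp_apply, ContinuousLinearMap.adjoint_inner_right, tilde_tmul,
        tilde_tmul, hV, one_apply_eq_self, inner_intTmul]
  have h := DFunLike.congr_fun this w
  rw [← ContinuousLinearMap.adjoint_inner_right, ← ContinuousLinearMap.comp_apply, h,
    one_apply_eq_self]

theorem IsIsometric.norm_tilde {V : CCRep P H} (hV : V.IsIsometric) (n : Fin k → ℕ)
    (z : IntTensor (X n) V.σ) : ‖V.tilde n z‖ = ‖z‖ := by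
  rw [norm_eq_sqrt_re_inner (𝕜 := ℂ), hV.inner_tilde, ← norm_eq_sqrt_re_inner]

theorem IsIsometric.isometry {V : CCRep P H} (hV : V.IsIsometric) (n : Fin k → ℕ) :
    Isometry (V.tilde n) :=
  AddMonoidHomClass.isometry_of_norm _ (hV.norm_tilde n)

theorem IsKernelFamily.exists_ccRep [CompleteSpace K] (hj : R.IsKernelFamily j)
    (hR : R.IsNondegenerate) : ∃ V : CCRep P K, V.IsIsometric ∧
      ∀ {p n q : Fin k → ℕ} (h : p + n = q) (x : X p) (z : IntTensor (X n) R.σ),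
        V.T p x (j n z) = j q (P.creation R.σ h x z) := by
  obtain ⟨V, hV⟩ := hj.exists_shift hR
  have hV0 : ∀ (a : A) (n : Fin k → ℕ) (z : IntTensor (X n) R.σ),
      V 0 (P.unit.symm a) (j n z) = j n (P.leftAct R.σ a z) := fun a n z => hV _ _ _
  let ρ : A →⋆ₙₐ[ℂ] (K →L[ℂ] K) :=
    { toFun := fun a => V 0 (P.unit.symm a)
      map_smul' := fun c a => by simp
      map_zero' := by simp
      map_add' := fun a b => by simp
      map_mul' := fun a b => hj.ext fun n z => by
        rw [mul_apply_eq_comp, hV0, hV0, hV0, P.leftAct_mul]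
      map_star' := fun a => hj.ext fun n z => hj.ext_inner fun m w => by
        rw [ContinuousLinearMap.star_eq_adjoint, ContinuousLinearMap.adjoint_inner_right, hV0, hV0,
          hj.inner_leftAct] }
  have hρ : ∀ (a : A) (n : Fin k → ℕ) (z : IntTensor (X n) R.σ),
      ρ a (j n z) = j n (P.leftAct R.σ a z) := hV0
  have hiso : ∀ (n : Fin k → ℕ) (x y : X n) (g h : K), ⟪V n x g, V n y h⟫_ℂ =
      ⟪g, ρ (ip x y) h⟫_ℂ := by
    intro p x y g h
    have : ContinuousLinearMap.adjoint (V p x) ∘L V p y = ρ (ip x y) :=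
      hj.ext fun n z => hj.ext_inner fun m w => by
        rw [ContinuousLinearMap.comp_apply, ContinuousLinearMap.adjoint_inner_right,
          hV rfl, hV rfl, hρ, hj.inner_creation hR]
    rw [← this, ContinuousLinearMap.comp_apply, ContinuousLinearMap.adjoint_inner_right]
  refine ⟨⟨ρ, V, fun x => ?_, fun p a x => ?_, fun p a x => ?_, fun p _ => ?_,
    fun {p m q} h x y => ?_⟩, hiso, fun h x z => hV h x z⟩
  · exact congrArg (V 0) (P.unit.symm_apply_apply x).symm
  · exact hj.ext fun n z => by
      rw [ContinuousLinearMap.comp_apply, hV rfl, hV rfl, hρ, P.leftAct_creation]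
  · exact hj.ext fun n z => by
      rw [ContinuousLinearMap.comp_apply, hV rfl, hρ, hV rfl, P.creation_leftAct]
  -- The required inequality is an equality, because `V_p(x)^* V_p(y) = ρ(⟨x, y⟩)`.
  · refine isCompletelyContractive_of_norm_sum_le (σ := ρ) fun N ξ h =>
      le_of_sq_le_sq (le_of_eq ?_) (norm_nonneg _)
    rw [← Complex.ofReal_inj, ofReal_norm_sq_eq_inner, ofReal_norm_sq_eq_inner]
    simp only [sum_inner, inner_sum, inner_intTmul, hiso]
  · exact hj.ext fun n z => by
      rw [ContinuousLinearMap.comp_apply, hV (q := m + n) rfl, hV (q := q + n) rfl,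
        hV (q := q + n) (by rw [← h, add_assoc]),
        P.creation_mul R.σ h rfl rfl (by rw [← h, add_assoc])]

end CCRep

/-! ### Regular isometric dilations -/

section Dilation

variable {A : Type*} [NonUnitalCStarAlgebra A] [PartialOrder A]
    [StarOrderedRing A] {k : ℕ} {X : (Fin k → ℕ) → Type*} [∀ n, NormedAddCommGroup (X n)]
    [∀ n, NormedSpace ℂ (X n)] [∀ n, CompleteSpace (X n)] [∀ n, CStarCorrespondence A (X n)]
    {P : ProductSystem A X} {H : Type*} [NormedAddCommGroup H] [InnerProductSpace ℂ H]
    [CompleteSpace H]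
    {R : CCRep P H} {p m n q : Fin k → ℕ} {K : Type*} [NormedAddCommGroup K]
    [InnerProductSpace ℂ K] [CompleteSpace K] {V : CCRep P K} {ι : H →ₗᵢ[ℂ] K}

theorem idTensorIncl_tmul {E : Type*} [NormedAddCommGroup E] [NormedSpace ℂ E]
    [CompleteSpace E] [CStarCorrespondence A E] {σ : A →⋆ₙₐ[ℂ] (H →L[ℂ] H)}
    {ρ : A →⋆ₙₐ[ℂ] (K →L[ℂ] K)} (hι : ∀ a h, ρ a (ι h) = ι (σ a h)) (x : E) (h : H) :
    idTensorIncl E σ ρ ι (intTmul σ x h) = intTmul ρ x (ι h) := by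
  refine intLift_tmul σ _ 1 (fun N ξ g => ?_) x h
  rw [one_mul]
  refine le_of_sq_le_sq (le_of_eq ?_) (norm_nonneg _)
  rw [← Complex.ofReal_inj, ofReal_norm_sq_eq_inner, ofReal_norm_sq_eq_inner]
  simp only [LinearMap.compl₂_apply, LinearIsometry.coe_toLinearMap, sum_inner, inner_sum,
    inner_intTmul, hι, ι.inner_map_map]

namespace CCRep

theorem IsKernelFamily.exists_dilation {j : ∀ n, IntTensor (X n) R.σ →ₗ[ℂ] K}
    (hj : R.IsKernelFamily j) (hR : R.IsNondegenerate) (hV : V.IsIsometric)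
    (hVj : ∀ {p n q : Fin k → ℕ} (h : p + n = q) (x : X p) (z : IntTensor (X n) R.σ),
      V.T p x (j n z) = j q (P.creation R.σ h x z)) :
    ∃ ι : H →ₗᵢ[ℂ] K, IsRegularIsometricDilation R V ι ∧ IsMinimalDilation V ι := by
  let ι : H →ₗᵢ[ℂ] K :=
    { toLinearMap := j 0 ∘ₗ (ContinuousLinearMap.adjoint (R.tilde 0)).toLinearMap
      norm_map' := fun h => by
        rw [norm_eq_sqrt_re_inner (𝕜 := ℂ), norm_eq_sqrt_re_inner (𝕜 := ℂ) h]
        congr 2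
        simp only [LinearMap.comp_apply, ContinuousLinearMap.coe_coe]
        rw [hj.inner_same hR, ContinuousLinearMap.adjoint_inner_left, hR.tilde_zero_adjoint] }
  have hι : ∀ h, ι h = j 0 (ContinuousLinearMap.adjoint (R.tilde 0) h) := fun _ => rfl
  have hVι : ∀ (n : Fin k → ℕ) (x : X n) (h : H), V.T n x (ι h) = j n (intTmul R.σ x h) :=
    fun n x h => by rw [hι, hVj (add_zero n), hR.creation_adjoint_tilde_zero]
  have hres : ∀ a h, V.σ a (ι h) = ι (R.σ a h) := fun a h => by
    have := hVι 0 (P.unit.symm a) h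
    rw [V.T_zero, LinearEquiv.apply_symm_apply] at this
    rw [this, hι, adjoint_tilde_zero_σ]
  refine ⟨ι, ⟨fun i => hV.isometry _, fun i ξ h =>
    ⟨ContinuousLinearMap.adjoint (R.T (eIdx i) ξ) h, hj.ext_inner fun n z => ?_⟩, hres,
    fun n => ?_⟩, fun M hM hιM hinv => ?_⟩
  -- `V_i(ξ)^* ι h = ι T_i(ξ)^* h`: pairings against `j_0` are disjoint, so the kernel reduces to
  -- `T̃`, which turns creation by `ξ` into `T_i(ξ)`.
  · rw [ContinuousLinearMap.adjoint_inner_right, hVj rfl, hι, hι,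
      hj.inner_disjoint hR (m := 0) (fun _ => Or.inr rfl),
      hj.inner_disjoint hR (m := 0) (fun _ => Or.inr rfl),
      hR.tilde_zero_adjoint, hR.tilde_zero_adjoint, tilde_creation,
      ContinuousLinearMap.adjoint_inner_right]
  -- Regularity is the kernel formula for `n₊` and `n₋`, whose supports are disjoint.
  · refine intTensor_clm_ext _ fun x h => intTensor_ext_inner fun y g => ?_
    rw [ContinuousLinearMap.comp_apply, ContinuousLinearMap.comp_apply,
      ContinuousLinearMap.adjoint_inner_right, idTensorIncl_tmul hres, idTensorIncl_tmul hres,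
      symbol, symbol, ContinuousLinearMap.comp_apply, ContinuousLinearMap.comp_apply,
      ContinuousLinearMap.adjoint_inner_right, ContinuousLinearMap.adjoint_inner_right,
      V.tilde_tmul, V.tilde_tmul, hVι, hVι, hj.inner_disjoint hR]
    intro i
    omega
  · have key : ∀ (n : Fin k → ℕ) (z : IntTensor (X n) R.σ), j n z ∈ M := by
      intro n
      induction n using multiIndex_induction with
      | zero =>
        intro z
        have : j 0 z = ι (R.tilde 0 z) := by
          rw [hι, ← idTensorTilde_zero_add, idTensorTilde, hR.idTensorAdj_add_zero,
            ← ContinuousLinearMap.star_eq_adjoint, star_one]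
          rfl
        rw [this]
        exact hιM _
      | step n i ih =>
        intro z
        rw [← hM.submodule_topologicalClosure_eq, ← Submodule.orthogonal_orthogonal_eq_closure,
          Submodule.mem_orthogonal]
        intro v hv
        let J : IntTensor (X (eIdx i + n)) R.σ →L[ℂ] K := ⟨j _, hj.continuous hR _⟩
        -- A vector orthogonal to `M` is orthogonal to each `j(x ⊗ w) = V_i(x) j(w)`, hence to the
        -- whole range of `j` at `e_i + n` by totality.
        have h0 : innerSL ℂ v ∘L J = 0 := hR.creation_ext rfl (eIdx_ne_zero i) fun x w => by
          rw [ContinuousLinearMap.comp_apply, innerSL_apply_apply, zero_apply]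
          change ⟪v, j _ _⟫_ℂ = 0
          rw [← hVj rfl]
          exact (Submodule.mem_orthogonal' _ _).mp hv _ (hinv i x _ (ih w))
        exact DFunLike.congr_fun h0 z
    rw [← hj.dense, eq_comm]
    refine le_antisymm (Submodule.topologicalClosure_minimal _ ?_ hM) ?_
    · rw [Submodule.span_le]
      rintro _ ⟨n, z, rfl⟩
      exact key n z
    · rw [hj.dense]; exact le_top

/-- The identity `V_n(x)^* V_n(y) = ρ(⟨x, y⟩)` passes to products through the inner product of a
product system, and from products to `X(e_i + n)` by density, one variable at a time. At `n = 0` it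
holds for every representation. -/
theorem isIsometric_of_isometry (h : ∀ i, Isometry (V.tilde (eIdx i))) : V.IsIsometric := by
  have hi : ∀ (i : Fin k) (x y : X (eIdx i)) (ζ ξ : K), ⟪V.T _ x ζ, V.T _ y ξ⟫_ℂ =
      ⟪ζ, V.σ (ip x y) ξ⟫_ℂ := by
    intro i x y ζ ξ
    let L : IntTensor (X (eIdx i)) V.σ →ₗᵢ[ℂ] K :=
      ⟨(V.tilde (eIdx i)).toLinearMap, fun z => by
        simpa using (h i).norm_map_of_map_zero (map_zero _) z⟩
    have := L.inner_map_map (intTmul V.σ x ζ) (intTmul V.σ y ξ)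
    rw [inner_intTmul] at this
    rw [← this, ← V.tilde_tmul, ← V.tilde_tmul]
    rfl
  intro n
  induction n using multiIndex_induction with
  | zero => exact V.inner_T_zero
  | step n i ih =>
    by_cases hn : n = 0
    · subst hn
      generalize hq : eIdx i + 0 = q
      obtain rfl : eIdx i = q := by simpa using hq
      exact hi i
    · have hd : Dense (Submodule.span ℂ {z : X (eIdx i + n) | ∃ (x : X (eIdx i)) (y : X n),
          z = P.mul rfl x y} : Set (X (eIdx i + n))) := by
        rw [dense_iff_closure_eq, ← Submodule.topologicalClosure_coe,
          P.dense_mul rfl (eIdx_ne_zero i) hn, Submodule.top_coe]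
      have step : ∀ (x : X (eIdx i + n)) (ζ ξ : K),
          (∀ (y₁ : X (eIdx i)) (y₂ : X n), ⟪V.T _ x ζ, V.T _ (P.mul rfl y₁ y₂) ξ⟫_ℂ =
            ⟪ζ, V.σ (ip x (P.mul rfl y₁ y₂)) ξ⟫_ℂ) →
          ∀ y, ⟪V.T _ x ζ, V.T _ y ξ⟫_ℂ = ⟪ζ, V.σ (ip x y) ξ⟫_ℂ := by
        intro x ζ ξ hx y
        have hS : Continuous fun y : X (eIdx i + n) => ⟪V.T _ x ζ, V.T _ y ξ⟫_ℂ :=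
          continuous_const.inner (V.continuous_T_apply _ ξ)
        have hT : Continuous fun y : X (eIdx i + n) => ⟪intTmul V.σ x ζ, intTmul V.σ y ξ⟫_ℂ :=
          continuous_const.inner (continuous_intTmul_left V.σ ξ)
        rw [← inner_intTmul]
        refine congrFun (hS.ext_on hd hT fun y hy => ?_) y
        induction hy using Submodule.span_induction with
        | mem y hy =>
          obtain ⟨y₁, y₂, rfl⟩ := hy
          simp only [hx, inner_intTmul]
        | zero => simp
        | add a b _ _ ha hb =>
          simp only [map_add, add_apply, LinearMap.add_apply, inner_add_right] at ha hb ⊢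
          rw [ha, hb]
        | smul c a _ ha =>
          simp only [map_smul, smul_apply, LinearMap.smul_apply, inner_smul_right] at ha ⊢
          rw [ha]
      have h2 : ∀ (x₁ y₁ : X (eIdx i)) (x₂ y₂ : X n) (ζ ξ : K),
          ⟪V.T _ (P.mul rfl x₁ x₂) ζ, V.T _ (P.mul rfl y₁ y₂) ξ⟫_ℂ =
            ⟪ζ, V.σ (ip (P.mul rfl x₁ x₂) (P.mul (rfl : _ = eIdx i + n) y₁ y₂)) ξ⟫_ℂ := by
        intro x₁ y₁ x₂ y₂ ζ ξ
        rw [V.T_mul, V.T_mul, ContinuousLinearMap.comp_apply, ContinuousLinearMap.comp_apply, hi,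
          P.ip_mul, ← ContinuousLinearMap.comp_apply, ← V.T_lact, ih]
      intro x y ζ ξ
      refine step x ζ ξ (fun y₁ y₂ => ?_) y
      have h3 := step (P.mul rfl y₁ y₂) ξ ζ (fun x₁ x₂ => h2 _ _ _ _ _ _) x
      rw [← inner_conj_symm, h3, inner_conj_symm, ← star_ip x, V.inner_σ_left, star_star]

end CCRep

/-! ### Every minimal regular isometric dilation gives a kernel family -/

namespace IsRegularIsometricDilation

open CCRep

theorem isIsometric (hD : IsRegularIsometricDilation R V ι) : V.IsIsometric :=
  isIsometric_of_isometry hD.isometry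

variable (R V ι) in
/-- The operator `X n ⊗_σ H → K`, `x ⊗ h ↦ V_n(x) h`. -/
noncomputable def orbit (n : Fin k → ℕ) : IntTensor (X n) R.σ →L[ℂ] K :=
  V.tilde n ∘L idTensorIncl (X n) R.σ V.σ ι

theorem orbit_tmul (hD : IsRegularIsometricDilation R V ι) (x : X n) (h : H) :
    orbit R V ι n (intTmul R.σ x h) = V.T n x (ι h) := by
  rw [orbit, ContinuousLinearMap.comp_apply, idTensorIncl_tmul hD.restrict, tilde_tmul]

theorem T_orbit (hD : IsRegularIsometricDilation R V ι) (h : p + n = q) (x : X p)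
    (z : IntTensor (X n) R.σ) :
    V.T p x (orbit R V ι n z) = orbit R V ι q (P.creation R.σ h x z) := by
  have : V.T p x ∘L orbit R V ι n = orbit R V ι q ∘L P.creation R.σ h x :=
    intTensor_clm_ext _ fun y g => by
      rw [ContinuousLinearMap.comp_apply, ContinuousLinearMap.comp_apply, hD.orbit_tmul,
        P.creation_tmul, hD.orbit_tmul, V.T_mul h, ContinuousLinearMap.comp_apply]
  exact DFunLike.congr_fun this z

theorem inner_orbit_disjoint (hD : IsRegularIsometricDilation R V ι)
    (h : ∀ i, n i = 0 ∨ m i = 0) (z : IntTensor (X n) R.σ) (w : IntTensor (X m) R.σ) :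
    ⟪orbit R V ι n z, orbit R V ι m w⟫_ℂ = ⟪R.tilde n z, R.tilde m w⟫_ℂ := by
  -- Take `l = m - n`; disjointness of the supports makes `m` its positive and `n` its negative
  -- part.
  obtain ⟨l, rfl, rfl⟩ : ∃ l : Fin k → ℤ, m = (fun i => (l i).toNat) ∧
      n = (fun i => (-l i).toNat) :=
    ⟨fun i => m i - n i, funext fun i => by have := h i; dsimp only; omega,
      funext fun i => by have := h i; dsimp only; omega⟩
  have h1 := DFunLike.congr_fun (hD.regular l) w
  rw [← ContinuousLinearMap.adjoint_inner_right (R.tilde _), ← ContinuousLinearMap.comp_apply]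
  change _ = ⟪z, R.symbol l w⟫_ℂ
  rw [← h1, ContinuousLinearMap.comp_apply, ContinuousLinearMap.adjoint_inner_right,
    ContinuousLinearMap.comp_apply, symbol, ContinuousLinearMap.comp_apply,
    ContinuousLinearMap.adjoint_inner_right]
  rfl

theorem isKernelFamily_orbit (hD : IsRegularIsometricDilation R V ι) (hM : IsMinimalDilation V ι)
    (hR : R.IsNondegenerate) : R.IsKernelFamily fun n => (orbit R V ι n).toLinearMap := by
  constructor
  · intro s a b n m h h' hab z w
    by_cases hs : s = 0
    · subst hs
      obtain rfl : a = n := by simpa using h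
      obtain rfl : b = m := by simpa using h'
      rw [idTensorTilde_zero_add, idTensorTilde_zero_add, ContinuousLinearMap.adjoint_inner_left,
        hR.tilde_zero_adjoint]
      exact hD.inner_orbit_disjoint hab z w
    -- On vectors `x ⊗ z'`, `y ⊗ w'` isometry of `V_s` leaves `ρ(⟨x, y⟩)` between orbits with
    -- disjoint indices, where regularity applies. Totality then extends this in each variable
    -- separately, which requires `s ≠ 0`.
    · have key : ∀ (x y : X s) z' w', ⟪orbit R V ι n (P.creation R.σ h x z'),
          orbit R V ι m (P.creation R.σ h' y w')⟫_ℂ =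
          ⟪R.idTensorTilde h (P.creation R.σ h x z'),
            R.idTensorTilde h' (P.creation R.σ h' y w')⟫_ℂ := by
        intro x y z' w'
        rw [idTensorTilde_creation, idTensorTilde_creation, inner_intTmul, ← hD.T_orbit,
          ← hD.T_orbit, hD.isIsometric, ← R.tilde_leftAct, ← hD.inner_orbit_disjoint hab]
        congr 1
        rw [ProductSystem.leftAct, ← hD.T_orbit, V.T_zero, LinearEquiv.apply_symm_apply]
      have h1 : ∀ y w', ContinuousLinearMap.adjoint (orbit R V ι n)
          (orbit R V ι m (P.creation R.σ h' y w')) =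
          R.idTensorAdj h (R.idTensorTilde h' (P.creation R.σ h' y w')) := by
        intro y w'
        have : innerSL ℂ (ContinuousLinearMap.adjoint (orbit R V ι n)
          (orbit R V ι m (P.creation R.σ h' y w'))) = innerSL ℂ
          (R.idTensorAdj h (R.idTensorTilde h' (P.creation R.σ h' y w'))) :=
          hR.creation_ext h hs fun x z' => by
            rw [innerSL_apply_apply, innerSL_apply_apply, ContinuousLinearMap.adjoint_inner_left,
              ← inner_idTensorTilde_right, ← inner_conj_symm, key, inner_conj_symm]
        refine ext_inner_right ℂ fun v => ?_
        rw [← innerSL_apply_apply, this, innerSL_apply_apply]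
      have h2 : ContinuousLinearMap.adjoint (orbit R V ι n) ∘L orbit R V ι m =
          R.idTensorAdj h ∘L R.idTensorTilde h' := hR.creation_ext h' hs h1
      have h3 := DFunLike.congr_fun h2 w
      rw [ContinuousLinearMap.comp_apply, ContinuousLinearMap.comp_apply] at h3
      rw [inner_idTensorTilde_left, ← h3, ContinuousLinearMap.adjoint_inner_right]
      rfl
  -- Density is minimality: the closed span of the orbits contains `H`, through `j_0`, and is
  -- invariant under the `V_i(ξ)`.
  · refine hM _ (Submodule.isClosed_topologicalClosure _) (fun h => ?_) fun i ξ x hx => ?_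
    · refine Submodule.le_topologicalClosure _ (Submodule.subset_span
        ⟨0, ContinuousLinearMap.adjoint (R.tilde 0) h, ?_⟩)
      refine hR.funext (S := ι.toLinearMap)
        (T := (orbit R V ι 0 ∘L ContinuousLinearMap.adjoint (R.tilde 0)).toLinearMap)
        ι.continuous (ContinuousLinearMap.continuous _) (fun a g => ?_) h
      simp only [LinearIsometry.coe_toLinearMap, ContinuousLinearMap.coe_coe,
        ContinuousLinearMap.comp_apply]
      rw [adjoint_tilde_zero_σ, hD.orbit_tmul, V.T_zero, LinearEquiv.apply_symm_apply, hD.restrict]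
    · refine (Submodule.topologicalClosure_minimal _ (t := (Submodule.topologicalClosure
        (Submodule.span ℂ {x : K | ∃ n z, x = (orbit R V ι n).toLinearMap z})).comap
          (V.T (eIdx i) ξ).toLinearMap) ?_ ?_) hx
      · rw [Submodule.span_le]
        rintro _ ⟨n, z, rfl⟩
        refine Submodule.le_topologicalClosure _ (Submodule.subset_span ⟨eIdx i + n, _,
          hD.T_orbit rfl ξ z⟩)
      · exact (Submodule.isClosed_topologicalClosure _).preimage (V.T (eIdx i) ξ).continuous

end IsRegularIsometricDilation

end Dilation

/-! ### Range projections, double commutation and nondegeneracy of the dilation -/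

section Dilation

variable {A : Type*} [NonUnitalCStarAlgebra A] [PartialOrder A]
    [StarOrderedRing A] {k : ℕ} {X : (Fin k → ℕ) → Type*} [∀ n, NormedAddCommGroup (X n)]
    [∀ n, NormedSpace ℂ (X n)] [∀ n, CompleteSpace (X n)] [∀ n, CStarCorrespondence A (X n)]
    {P : ProductSystem A X} {H : Type*} [NormedAddCommGroup H] [InnerProductSpace ℂ H]
    [CompleteSpace H]
    {R : CCRep P H} {p m n q : Fin k → ℕ} {K : Type*} [NormedAddCommGroup K]
    [InnerProductSpace ℂ K] [CompleteSpace K] {V : CCRep P K} {ι : H →ₗᵢ[ℂ] K}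

namespace CCRep

variable (V) in
/-- The projection `Ṽ_n Ṽ_n^*` onto the range of an isometry `Ṽ_n`. -/
noncomputable def rangeProj (n : Fin k → ℕ) : K →L[ℂ] K :=
  V.tilde n ∘L ContinuousLinearMap.adjoint (V.tilde n)

theorem rangeProj_apply (n : Fin k → ℕ) (ζ : K) :
    V.rangeProj n ζ = V.tilde n (ContinuousLinearMap.adjoint (V.tilde n) ζ) := rfl

theorem inner_rangeProj (n : Fin k → ℕ) (ζ ξ : K) :
    ⟪V.rangeProj n ζ, ξ⟫_ℂ = ⟪ζ, V.rangeProj n ξ⟫_ℂ := by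
  rw [rangeProj_apply, rangeProj_apply, ← ContinuousLinearMap.adjoint_inner_right,
    ContinuousLinearMap.adjoint_inner_left]

theorem IsIsometric.rangeProj_tilde (hV : V.IsIsometric) (n : Fin k → ℕ)
    (z : IntTensor (X n) V.σ) : V.rangeProj n (V.tilde n z) = V.tilde n z := by
  rw [rangeProj_apply]
  congr 1
  refine ext_inner_right ℂ fun w => ?_
  rw [ContinuousLinearMap.adjoint_inner_left, hV.inner_tilde]

theorem IsIsometric.rangeProj_T (hV : V.IsIsometric) (n : Fin k → ℕ) (x : X n) (ζ : K) :
    V.rangeProj n (V.T n x ζ) = V.T n x ζ := by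
  rw [← tilde_tmul, hV.rangeProj_tilde]

theorem rangeProj_eq_zero {ζ : K} (h : ∀ x, ContinuousLinearMap.adjoint (V.T n x) ζ = 0) :
    V.rangeProj n ζ = 0 := by
  have : ContinuousLinearMap.adjoint (V.tilde n) ζ = 0 := intTensor_ext_inner fun x g => by
    rw [ContinuousLinearMap.adjoint_inner_right, tilde_tmul, inner_zero_right,
      ← ContinuousLinearMap.adjoint_inner_right, h, inner_zero_right]
  rw [rangeProj_apply, this, map_zero]

variable {J : ∀ n, IntTensor (X n) R.σ →ₗ[ℂ] K}

theorem IsKernelFamily.rangeProj_of_eIdx_add (hJ : R.IsKernelFamily J) (hR : R.IsNondegenerate)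
    (hV : V.IsIsometric)
    (hVJ : ∀ {p n q : Fin k → ℕ} (h : p + n = q) (x : X p) (z : IntTensor (X n) R.σ),
      V.T p x (J n z) = J q (P.creation R.σ h x z))
    {j : Fin k} (h : eIdx j + n = q) (z : IntTensor (X q) R.σ) :
    V.rangeProj (eIdx j) (J q z) = J q z := by
  let L : IntTensor (X q) R.σ →L[ℂ] K := ⟨J q, hJ.continuous hR q⟩
  have : V.rangeProj (eIdx j) ∘L L = L := hR.creation_ext h (eIdx_ne_zero j) fun x w => by
    rw [ContinuousLinearMap.comp_apply]
    change V.rangeProj (eIdx j) (J q _) = J q _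
    rw [← hVJ, hV.rangeProj_T]
  exact DFunLike.congr_fun this z

/-- The right side already lies in the range of `Ṽ_j`, and its difference from `J_n(z)` is
annihilated by every `V_j(x)^*`, by the kernel identity for `I ⊗ T̃_j^*`. -/
theorem IsKernelFamily.rangeProj_of_eq_zero (hJ : R.IsKernelFamily J) (hR : R.IsNondegenerate)
    (hdc : R.IsDoublyCommuting) (hV : V.IsIsometric)
    (hVJ : ∀ {p n q : Fin k → ℕ} (h : p + n = q) (x : X p) (z : IntTensor (X n) R.σ),
      V.T p x (J n z) = J q (P.creation R.σ h x z))
    {j : Fin k} (hn : n j = 0) (h : n + eIdx j = q) (z : IntTensor (X n) R.σ) :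
    V.rangeProj (eIdx j) (J n z) = J q (R.idTensorAdj h z) := by
  rw [← hJ.rangeProj_of_eIdx_add hR hV hVJ (n := n) (by rw [add_comm, h]) (R.idTensorAdj h z),
    ← sub_eq_zero, ← map_sub]
  refine rangeProj_eq_zero fun x => hJ.ext_inner fun m w => ?_
  rw [ContinuousLinearMap.adjoint_inner_right, inner_sub_right, hVJ rfl,
    hJ.inner_idTensorAdj hR hdc hn h (add_comm m _), sub_self, inner_zero_right]

/-- Creation by `x ∈ E_i` leaves the `j`-th coordinate of the index unchanged, so both sides fall
under the same one of the two formulas for the projection; and it commutes with `I ⊗ T̃_j^*`. -/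
theorem IsKernelFamily.rangeProj_T (hJ : R.IsKernelFamily J) (hR : R.IsNondegenerate)
    (hdc : R.IsDoublyCommuting) (hV : V.IsIsometric)
    (hVJ : ∀ {p n q : Fin k → ℕ} (h : p + n = q) (x : X p) (z : IntTensor (X n) R.σ),
      V.T p x (J n z) = J q (P.creation R.σ h x z))
    {i j : Fin k} (hij : i ≠ j) (x : X (eIdx i)) (ζ : K) :
    V.rangeProj (eIdx j) (V.T (eIdx i) x ζ) = V.T (eIdx i) x (V.rangeProj (eIdx j) ζ) := by
  have : V.rangeProj (eIdx j) ∘L V.T (eIdx i) x = V.T (eIdx i) x ∘L V.rangeProj (eIdx j) :=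
    hJ.ext fun n z => by
      rw [ContinuousLinearMap.comp_apply, ContinuousLinearMap.comp_apply, hVJ rfl]
      by_cases hn : n j = 0
      · rw [hJ.rangeProj_of_eq_zero hR hdc hV hVJ hn rfl,
          hJ.rangeProj_of_eq_zero hR hdc hV hVJ (q := eIdx i + n + eIdx j)
            (by rw [Pi.add_apply, eIdx_apply, if_neg hij.symm, hn]) rfl,
          hVJ (add_assoc _ _ _).symm, R.idTensorAdj_creation rfl rfl (add_assoc _ _ _).symm rfl]
      · obtain ⟨m, rfl⟩ := exists_eq_eIdx_add hn
        rw [hJ.rangeProj_of_eIdx_add hR hV hVJ rfl,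
          hJ.rangeProj_of_eIdx_add hR hV hVJ (n := eIdx i + m) (by abel), hVJ rfl]
  exact DFunLike.congr_fun this ζ

/-- Let `Q_i`, `Q_j` be the range projections. Applying the isometry `Ṽ` at `e_i + e_j` turns the
right side of double commutation into `⟪V_j(y) Q_i ξ, V_i(x) Q_j ζ⟫`. By the commutation hypothesis
and `Q_i V_i(x) = V_i(x)`, `Q_j V_j(y) = V_j(y)`, both projections disappear. -/
theorem IsIsometric.isDoublyCommuting (hV : V.IsIsometric)
    (h : ∀ i j, i ≠ j → ∀ (x : X (eIdx i)) (ζ : K),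
      V.rangeProj (eIdx j) (V.T (eIdx i) x ζ) = V.T (eIdx i) x (V.rangeProj (eIdx j) ζ)) :
    V.IsDoublyCommuting := by
  intro i j hij
  refine intTensor_clm_ext _ fun x ζ => intTensor_ext_inner fun y ξ => ?_
  rw [ContinuousLinearMap.comp_apply, ContinuousLinearMap.adjoint_inner_right, tilde_tmul,
    tilde_tmul, ContinuousLinearMap.comp_apply, inner_idTensorTilde_right, idTensorAdj_tmul,
    idTensorAdj_tmul, ← hV.inner_tilde, tilde_creation, tilde_creation, ← rangeProj_apply,
    ← rangeProj_apply, ← h i j hij, ← h j i hij.symm, inner_rangeProj, h i j hij, hV.rangeProj_T,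
    ← h i j hij, ← inner_rangeProj, hV.rangeProj_T]

end CCRep

namespace IsRegularIsometricDilation

open CCRep

theorem isDoublyCommuting (hD : IsRegularIsometricDilation R V ι) (hM : IsMinimalDilation V ι)
    (hR : R.IsNondegenerate) (hdc : R.IsDoublyCommuting) : V.IsDoublyCommuting :=
  hD.isIsometric.isDoublyCommuting fun _ _ hij x ζ =>
    (hD.isKernelFamily_orbit hM hR).rangeProj_T hR hdc hD.isIsometric
      (fun h x z => hD.T_orbit h x z) hij x ζ

/-- Test minimality on the closed span of `ρ(A)K`: it contains `H` because `σ` is nondegenerate, and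
it contains every `V_i(ξ)x` because `ξ` is a limit of combinations of vectors `φ(a)y` and
`V_i(φ(a)y) = ρ(a)V_i(y)`. -/
theorem isNondegenerate (hD : IsRegularIsometricDilation R V ι) (hM : IsMinimalDilation V ι)
    (hR : R.IsNondegenerate) (hE : ∀ i : Fin k, IsEssential A (X (eIdx i))) :
    V.IsNondegenerate := by
  obtain ⟨M, hMeq⟩ : ∃ M, M = (Submodule.span ℂ
      {h : K | ∃ (a : A) (h' : K), h = V.σ a h'}).topologicalClosure := ⟨_, rfl⟩
  have hcl : IsClosed (M : Set K) := hMeq ▸ Submodule.isClosed_topologicalClosure _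
  have hmem : ∀ a ζ, V.σ a ζ ∈ M := fun a ζ =>
    hMeq ▸ Submodule.le_topologicalClosure _ (Submodule.subset_span ⟨a, ζ, rfl⟩)
  rw [IsNondegenerate, ← hMeq]
  refine hM _ hcl (fun h => ?_) fun i ξ x _ => ?_
  · have := Submodule.topologicalClosure_minimal
      (Submodule.span ℂ {h : H | ∃ (a : A) (h' : H), h = R.σ a h'})
      (t := M.comap ι.toLinearMap) (by
          rw [Submodule.span_le]
          rintro _ ⟨a, h', rfl⟩
          change ι (R.σ a h') ∈ M
          rw [← hD.restrict]
          exact hmem _ _) (hcl.preimage ι.continuous)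
    rw [hR] at this
    exact this (Submodule.mem_top (x := h))
  · have := Submodule.topologicalClosure_minimal
      (Submodule.span ℂ {y : X (eIdx i) | ∃ (a : A) (x : X (eIdx i)), y = lact a x})
      (t := M.comap ((ContinuousLinearMap.apply ℂ K x).toLinearMap ∘ₗ V.T (eIdx i))) (by
          rw [Submodule.span_le]
          rintro _ ⟨a, y, rfl⟩
          change V.T (eIdx i) (lact a y) x ∈ M
          rw [V.T_lact]
          exact hmem _ _) (hcl.preimage (V.continuous_T_apply _ x))
    have hE' := hE i
    rw [IsEssential] at hE'
    rw [hE'] at this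
    exact this (Submodule.mem_top (x := ξ))

end IsRegularIsometricDilation

end Dilation

theorem theorem3p8 {A : Type uA} [NonUnitalCStarAlgebra A] [PartialOrder A]
    [StarOrderedRing A] {k : ℕ} {X : (Fin k → ℕ) → Type uX} [∀ n, NormedAddCommGroup (X n)]
    [∀ n, NormedSpace ℂ (X n)] [∀ n, CompleteSpace (X n)] [∀ n, CStarCorrespondence A (X n)]
    (P : ProductSystem A X) {H : Type uH} [NormedAddCommGroup H] [InnerProductSpace ℂ H]
    [CompleteSpace H] (R : CCRep P H) (hR : R.IsNondegenerate) (hdc : R.IsDoublyCommuting) :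
    -- the sum factors as a product of commuting positive operators and is positive
    (∀ v : Finset (Fin k),
      (∀ i ∈ v, (R.defectFactor v i).IsPositive) ∧
      (∃ hc : (v : Set (Fin k)).Pairwise (Function.onFun Commute (R.defectFactor v)),
        R.defect v = v.noncommProd (R.defectFactor v) hc) ∧
      (R.defect v).IsPositive) ∧
    -- there is a minimal regular isometric dilation
    (∃ (K : Type (max uX uH)) (_ : NormedAddCommGroup K) (_ : InnerProductSpace ℂ K)
      (_ : CompleteSpace K) (V : CCRep P K) (ι : H →ₗᵢ[ℂ] K),
      IsRegularIsometricDilation R V ι ∧ IsMinimalDilation V ι) ∧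
    -- every minimal regular isometric dilation is doubly commuting, and its representation of `A`
    -- is nondegenerate if the left actions of `A` are
    (∀ (K : Type uK) [NormedAddCommGroup K] [InnerProductSpace ℂ K] [CompleteSpace K]
      (V : CCRep P K) (ι : H →ₗᵢ[ℂ] K),
      IsRegularIsometricDilation R V ι → IsMinimalDilation V ι →
        V.IsDoublyCommuting ∧
        ((∀ i : Fin k, IsEssential A (X (eIdx i))) → V.IsNondegenerate)) := by
  refine ⟨fun v => ⟨fun i hi => ?_, ⟨hdc.pairwise_commute_defectFactor hR v,
    hdc.defect_eq_noncommProd hR v _⟩, ?_⟩, ?_, ?_⟩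
  · rw [← ContinuousLinearMap.nonneg_iff_isPositive]
    exact CCRep.one_sub_idTensorSq_nonneg (CCRep.eIdx_le_eSet hi)
  · rw [← ContinuousLinearMap.nonneg_iff_isPositive]
    -- `R.defect v` is by definition `R.defectAt` at the index `e(v)`, none of whose coordinates in
    -- `v` vanishes.
    exact hdc.defectAt_nonneg hR fun j hj => by simp [eSet_apply, hj]
  · obtain ⟨K, i₁, i₂, i₃, j, hj⟩ := hdc.exists_isKernelFamily hR
    obtain ⟨V, hV, hVj⟩ := hj.exists_ccRep hR
    obtain ⟨ι, h⟩ := hj.exists_dilation hR hV hVj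
    exact ⟨K, i₁, i₂, i₃, V, ι, h⟩
  · intro K _ _ _ V ι hD hM
    exact ⟨hD.isDoublyCommuting hM hR hdc, hD.isNondegenerate hM hR⟩
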